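/- Let $V$ be an arbitrary real vector space. **Trees.** A (non-planar rooted) tree $\mathfrak t$ is an isomorphism class of finite partially ordered sets with a unique minimal element $\mathrm r(\mathfrak t)$ (the root) in which the elements strictly below any given element are totally ordered. Let $\mathrm v(\mathfrak t)=\mathfrak t\setminus\{\mathrm r(\mathfrak t)\}$, let $|\mathfrak t|=\#\mathrm v(\mathfrak t)$ be the degree, let $\mathrm c(\mathrm r(\mathfrak t))$ be the set of children of the root (the minimal elements of $\mathrm v(\mathfrak t)$), and let $\mathbf 1$ be the tree of degree $0$. Let $\mathrm{SG}(\mathfrak t)$ be the group of order-preserving bijections of $\mathrm v(\mathfrak t)$, acting on $V^{\otimes \mathrm v(\mathfrak t)}$ by permuting tensor factors, and put $$V^{\otimes\mathfrak t}=V^{\otimes \mathrm v(\mathfrak t)}\big/\ker(\mathrm{sym}_{\mathrm{SG}(\mathfrak t)}),\qquad \mathrm{sym}_G=\tfrac1{|G|}\sum_{\sigma\in G}\sigma .$$ The tree space is $\mathfrak{Tr}(V)=\bigoplus_{\mathfrak t}V^{\otimes\mathfrak t}$, with homogeneous parts $\mathfrak{Tr}^k(V)=\bigoplus_{|\mathfrak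 t|=k}V^{\otimes\mathfrak t}$, $k\ge 0$. It is spanned by elementary labelled trees $\mathbf t$, that is, the classes of elementary tensors, which label each vertex in $\mathrm v(\mathfrak t)$ by an element of $V$. **Operations.** They are defined on elementary labelled trees, each non-root vertex keeping its label, and extended (bi)linearly. * $\mathbf t\star\mathbf s=\sum_{d}\,[\mathbf t\stackrel{d}{\rightharpoonup}\mathbf s]$, the sum over all maps $d:\mathrm c(\mathrm r(\mathfrak t))\to\mathfrak s$. Here $\mathfrak t\stackrel{d}{\rightharpoonup}\mathfrak s$ is $\mathrm v(\mathfrak t)\sqcup\mathfrak s$ with the partial order generated by the given orders and the relations $d(c)\prec c$. * $\mathbf t\circ\mathbf s$ is the single term of this sum in which $d$ is constantly the root of $\mathfrak s$, so the two roots are identified. * If $\mathbf t=\mathbf t_1\circ\dots\circ\mathbf t_k$, where the $\mathbf t_i$ are the branches of $\mathbf t$ (the root of each $\mathfrak t_i$ has exactly one child), then $\Delta_{GL}(\mathbf t)=\sum_{I\subseteq\{1,\dots,k\}}\big(\bigcirc_{i\in I}\mathbf t_i\big)\otimes\big(\bigcirc_{i\notin I}\mathbf t_i\big)$, an empty product being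 $\mathbf 1$. * $\Delta_{CK}(\mathbf t)=\sum_{C}\mathbf P^C(\mathbf t)\otimes\mathbf R^C(\mathbf t)$, the sum over all admissible cuts $C$, that is, sets $C\subseteq\mathrm v(\mathfrak t)$ of pairwise incomparable vertices. Here $P^C(\mathfrak t)$ consists of a root and all vertices $v$ with $v\succeq w$ for some $w\in C$, and $R^C(\mathfrak t)$ consists of all the other vertices of $\mathfrak t$, including its root, both with the induced order. * The unit is $\eta(\lambda)=\lambda\mathbf 1$ for $\lambda\in\mathbb R$, and the counit $\varepsilon$ is the coefficient of $\mathbf 1$. **Proposition.** Each of $$\mathcal H_{GL}(V)=(\mathfrak{Tr}(V),\star,\eta,\Delta_{GL},\varepsilon)\quad\text{and}\quad \mathcal H_{CK}(V)=(\mathfrak{Tr}(V),\circ,\eta,\Delta_{CK},\varepsilon)$$ is a bialgebra over $\mathbb R$. It is graded by the subspaces $\mathfrak{Tr}^k(V)$: the product, the coproduct, the unit and the counit are homogeneous of degree $0$. It is connected: $\eta$ is an isomorphism of $\mathbb R$ onto $\mathfrak{Tr}^0(V)$. Moreover it has an antipode and is therefore a Hopf algebra. -/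

import Mathlib

open scoped TensorProduct DirectSum

universe u w

/-! ### Non-planar rooted trees as finite partially ordered sets -/

/-- A representative of a non-planar rooted tree: a finite partially ordered set with a least
element `⊥` (for a finite poset this is the same as a unique minimal element), the root, such
that the elements strictly below any given element form a chain. -/
structure RTree : Type 1 where
  carrier : Type
  [fin : Finite carrier]
  [ord : PartialOrder carrier]
  [bot : OrderBot carrier]
  chain : ∀ v : carrier, IsChain (· ≤ ·) (Set.Iio v)

namespace RTree

attribute [instance] RTree.fin RTree.ord RTree.bot

/-- The non-root vertices of a tree. -/
abbrev Vert (T : RTree) : Type := {x : T.carrier // x ≠ ⊥}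

/-- The children of the root. -/
abbrev RootChild (T : RTree) : Type := {c : T.carrier // ⊥ ⋖ c}

/-- The symmetry group: order-preserving bijections of the set of non-root vertices. -/
abbrev SG (T : RTree) : Type := T.Vert ≃o T.Vert

instance (T : RTree) : Finite T.SG := DFunLike.finite _

noncomputable instance (T : RTree) : Fintype T.SG := Fintype.ofFinite _

theorem exists_rootChild_le (T : RTree) (a : T.Vert) : ∃ c : T.RootChild, c.1 ≤ a.1 := by
  obtain ⟨m, hm, hmin⟩ := (Set.toFinite {x : T.carrier | x ≠ ⊥}).exists_le_minimal a.2
  refine ⟨⟨m, bot_lt_iff_ne_bot.2 hmin.1, fun x hx hxm => ?_⟩, hm⟩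
  exact hxm.not_ge (hmin.2 (bot_lt_iff_ne_bot.1 hx) hxm.le)

theorem comparable_of_le (T : RTree) {x y v : T.carrier} (hx : x ≤ v) (hy : y ≤ v) :
    x ≤ y ∨ y ≤ x := by
  rcases hx.eq_or_lt with rfl | hx
  · exact Or.inr hy
  rcases hy.eq_or_lt with rfl | hy
  · exact Or.inl hx.le
  exact (T.chain v).total hx hy

theorem rootChild_unique (T : RTree) {c c' : T.RootChild} {v : T.carrier}
    (hc : c.1 ≤ v) (hc' : c'.1 ≤ v) : c = c' := by
  apply Subtype.ext
  rcases T.comparable_of_le hc hc' with h | h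
  · by_contra hne
    exact c'.2.2 c.2.1 (lt_of_le_of_ne h hne)
  · by_contra hne
    exact c.2.2 c'.2.1 (lt_of_le_of_ne h (Ne.symm hne))

/-- The restriction of an isomorphism of trees to the non-root vertices. -/
def vertIso {T S : RTree} (φ : T.carrier ≃o S.carrier) : T.Vert ≃o S.Vert where
  toFun x := ⟨φ x.1, fun h => x.2 (by simpa using h)⟩
  invFun x := ⟨φ.symm x.1, fun h => x.2 (by simpa using h)⟩
  left_inv x := by simp
  right_inv x := by simp
  map_rel_iff' := by simp

/-- A symmetry of the non-root vertices extends to an automorphism of the tree. -/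
theorem exists_vertIso_eq {T S : RTree} (π : T.Vert ≃o S.Vert) :
    ∃ φ : T.carrier ≃o S.carrier, vertIso φ = π := by
  classical
  have aux : ∀ {A B : RTree} (ρ : A.Vert ≃o B.Vert) (x : B.carrier),
      (if h : (if h : x = ⊥ then (⊥ : A.carrier) else (ρ.symm ⟨x, h⟩).1) = ⊥ then (⊥ : B.carrier)
        else (ρ ⟨_, h⟩).1) = x := by
    intro A B ρ x
    by_cases h : x = ⊥
    · simp [h]
    · have := (ρ.symm ⟨x, h⟩).2
      simp [h, this]
  let e : T.carrier ≃ S.carrier :=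
    { toFun := fun x => if h : x = ⊥ then ⊥ else (π ⟨x, h⟩).1
      invFun := fun x => if h : x = ⊥ then ⊥ else (π.symm ⟨x, h⟩).1
      left_inv := fun x => aux π.symm x
      right_inv := fun x => aux π x }
  have he : ∀ {a b : T.carrier}, e a ≤ e b ↔ a ≤ b := by
    intro a b
    by_cases ha : a = ⊥
    · simp [e, ha]
    by_cases hb : b = ⊥
    · have := (π ⟨a, ha⟩).2
      simp [e, ha, hb, this]
    · simp [e, ha, hb]
  refine ⟨⟨e, he⟩, ?_⟩
  ext x
  have := x.2
  simp [vertIso, e, this]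

/-- Two representatives are equivalent if they are isomorphic as partially ordered sets. -/
instance setoid : Setoid RTree where
  r T S := Nonempty (T.carrier ≃o S.carrier)
  iseqv := ⟨fun _ => ⟨OrderIso.refl _⟩, fun ⟨φ⟩ => ⟨φ.symm⟩, fun ⟨φ⟩ ⟨ψ⟩ => ⟨φ.trans ψ⟩⟩

/-- The tree with only a root. -/
def single : RTree where
  carrier := Unit
  chain _ := Set.Subsingleton.isChain (Set.subsingleton_of_subsingleton)

/-- The underlying set of the tree obtained by attaching the children of the root of `T` to the
vertices of `S` as prescribed by `d`. -/
def GraftCarrier {T S : RTree} (_d : T.RootChild → S.carrier) : Type := T.Vert ⊕ S.carrier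

/-- The order on the grafted tree: the orders of `T` and `S` together with the relations
`d c < c` for the children `c` of the root of `T`, closed under transitivity. -/
def GraftCarrier.le {T S : RTree} (d : T.RootChild → S.carrier) :
    T.Vert ⊕ S.carrier → T.Vert ⊕ S.carrier → Prop
  | .inl a, .inl b => a.1 ≤ b.1
  | .inr s, .inr s' => s ≤ s'
  | .inr s, .inl a => ∃ c : T.RootChild, c.1 ≤ a.1 ∧ s ≤ d c
  | .inl _, .inr _ => False

instance {T S : RTree} (d : T.RootChild → S.carrier) : Finite (GraftCarrier d) :=
  inferInstanceAs (Finite (T.Vert ⊕ S.carrier))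

instance {T S : RTree} (d : T.RootChild → S.carrier) : PartialOrder (GraftCarrier d) where
  le := GraftCarrier.le d
  le_refl x := by
    rcases x with a | s
    · exact le_refl a.1
    · exact le_refl s
  le_trans x y z hxy hyz := by
    rcases x with a | s <;> rcases y with b | s' <;> rcases z with c | s'' <;>
      simp only [GraftCarrier.le] at hxy hyz ⊢
    · exact hxy.trans hyz
    · obtain ⟨k, hk, h⟩ := hxy
      exact ⟨k, hk.trans hyz, h⟩
    · obtain ⟨k, hk, h⟩ := hyz
      exact ⟨k, hk, hxy.trans h⟩
    · exact hxy.trans hyz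
  le_antisymm x y hxy hyx := by
    rcases x with a | s <;> rcases y with b | s' <;> simp only [GraftCarrier.le] at hxy hyx
    · exact congrArg Sum.inl (Subtype.ext (le_antisymm hxy hyx))
    · exact congrArg Sum.inr (le_antisymm hxy hyx)

instance {T S : RTree} (d : T.RootChild → S.carrier) : OrderBot (GraftCarrier d) where
  bot := .inr ⊥
  bot_le x := by
    rcases x with a | s
    · obtain ⟨c, hc⟩ := T.exists_rootChild_le a
      exact ⟨c, hc, bot_le⟩
    · exact bot_le (a := s)

/-- The tree obtained by grafting `T` onto `S` along the grafting map `d`. -/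
def graft {T S : RTree} (d : T.RootChild → S.carrier) : RTree where
  carrier := GraftCarrier d
  chain v := by
    intro x hx y hy _
    replace hx : GraftCarrier.le d x v := (show x < v from hx).le
    replace hy : GraftCarrier.le d y v := (show y < v from hy).le
    change GraftCarrier.le d x y ∨ GraftCarrier.le d y x
    rcases x with a | s <;> rcases y with b | s' <;> rcases v with c | r <;>
      simp only [GraftCarrier.le] at hx hy ⊢
    · exact T.comparable_of_le hx hy
    · obtain ⟨k, hk, h⟩ := hy
      obtain ⟨l, hl⟩ := T.exists_rootChild_le a
      exact Or.inr ⟨l, hl, T.rootChild_unique hk (hl.trans hx) ▸ h⟩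
    · obtain ⟨k, hk, h⟩ := hx
      obtain ⟨l, hl⟩ := T.exists_rootChild_le b
      exact Or.inl ⟨l, hl, T.rootChild_unique hk (hl.trans hy) ▸ h⟩
    · obtain ⟨k, hk, h⟩ := hx
      obtain ⟨l, hl, h'⟩ := hy
      obtain rfl := T.rootChild_unique hk hl
      exact S.comparable_of_le h h'
    · exact S.comparable_of_le hx hy

/-- The root-merging `T ∘ S`: every child of the root of `T` is attached to the root of `S`. -/
abbrev merge (T S : RTree) : RTree := graft (T := T) (S := S) fun _ => ⊥

/-- The non-root vertices of a grafted tree are those of `T` together with those of `S`. -/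
def graftVert {T S : RTree} (d : T.RootChild → S.carrier) :
    T.Vert ⊕ S.Vert ≃ (graft d).Vert where
  toFun := Sum.elim (fun a => ⟨(Sum.inl a : T.Vert ⊕ S.carrier), fun h => nomatch h⟩)
    (fun s => ⟨(Sum.inr s.1 : T.Vert ⊕ S.carrier), fun h => s.2 (Sum.inr.inj h)⟩)
  invFun x := match x with
    | ⟨.inl a, _⟩ => .inl a
    | ⟨.inr s, h⟩ => .inr ⟨s, fun hs => h (congrArg Sum.inr hs)⟩
  left_inv x := by rcases x with a | s <;> rfl
  right_inv x := by rcases x with ⟨a | s, h⟩ <;> rfl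

/-- The tree formed by the root of `T` and the vertices in `U`, with the induced order. -/
def restrict (T : RTree) (U : Set T.carrier) : RTree where
  carrier := {x : T.carrier // x = ⊥ ∨ x ∈ U}
  bot := { bot := ⟨⊥, Or.inl rfl⟩, bot_le := fun x => bot_le (a := x.1) }
  chain v := by
    intro x hx y hy _
    exact T.comparable_of_le (x := x.1) (y := y.1) (v := v.1) (le_of_lt hx) (le_of_lt hy)

open scoped Classical in
/-- The non-root vertices of `T` are split into those in `U` and those outside `U`. -/
noncomputable def restrictVert (T : RTree) (U : Set T.carrier) :
    (T.restrict U).Vert ⊕ (T.restrict Uᶜ).Vert ≃ T.Vert where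
  toFun := Sum.elim (fun a => ⟨a.1.1, fun h => a.2 (Subtype.ext h)⟩)
    (fun a => ⟨a.1.1, fun h => a.2 (Subtype.ext h)⟩)
  invFun x := if h : x.1 ∈ U then .inl ⟨⟨x.1, Or.inr h⟩, fun h' => x.2 (congrArg Subtype.val h')⟩
    else .inr ⟨⟨x.1, Or.inr h⟩, fun h' => x.2 (congrArg Subtype.val h')⟩
  left_inv x := by
    rcases x with ⟨⟨x, hx⟩, h⟩ | ⟨⟨x, hx⟩, h⟩
    · have : x ∈ U := hx.resolve_left fun h' => h (Subtype.ext h')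
      simp [this]
    · have : x ∉ U := hx.resolve_left fun h' => h (Subtype.ext h')
      simp [this]
  right_inv x := by
    by_cases h : x.1 ∈ U <;> simp [h]

/-- The vertices that lie weakly above some element of `C`. -/
def above (T : RTree) (C : Set T.carrier) : Set T.carrier := {v | ∃ w ∈ C, w ≤ v}

/-- The admissible cuts: sets of pairwise incomparable non-root vertices. -/
abbrev Cut (T : RTree) : Type :=
  {C : Set T.carrier // (⊥ : T.carrier) ∉ C ∧ IsAntichain (· ≤ ·) C}

/-- The vertices of the branches of `T` whose lowest vertices are the elements of `I`. -/
abbrev branches (T : RTree) (I : Set T.RootChild) : Set T.carrier :=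
  T.above (Subtype.val '' I)

/-- The branches outside `I` make up exactly the vertices that are not in a branch of `I`. -/
theorem restrict_branches_compl (T : RTree) (I : Set T.RootChild) :
    T.restrict (T.branches I)ᶜ = T.restrict (T.branches Iᶜ) := by
  have : ∀ x : T.carrier, (x = ⊥ ∨ x ∈ (T.branches I)ᶜ) ↔ (x = ⊥ ∨ x ∈ T.branches Iᶜ) := by
    intro x
    by_cases hx : x = ⊥
    · simp [hx]
    simp only [hx, false_or]
    constructor
    · intro h
      obtain ⟨c, hc⟩ := T.exists_rootChild_le ⟨x, hx⟩
      exact ⟨c.1, ⟨c, fun hI => h ⟨c.1, ⟨c, hI, rfl⟩, hc⟩, rfl⟩, hc⟩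
    · rintro ⟨_, ⟨c, hcI, rfl⟩, hc⟩ ⟨_, ⟨c', hcI', rfl⟩, hc'⟩
      exact hcI (T.rootChild_unique hc' hc ▸ hcI')
  have h2 : ∀ p q : T.carrier → Prop, p = q → ∀ (hp : p ⊥) (hq : q ⊥)
      (cp : ∀ v : {x // p x}, IsChain (· ≤ ·) (Set.Iio v))
      (cq : ∀ v : {x // q x}, IsChain (· ≤ ·) (Set.Iio v)),
      (@RTree.mk {x // p x} _ _ { bot := ⟨⊥, hp⟩, bot_le := fun x => bot_le (a := x.1) } cp) =
      (@RTree.mk {x // q x} _ _ { bot := ⟨⊥, hq⟩, bot_le := fun x => bot_le (a := x.1) } cq) := by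
    rintro p _ rfl _ _ _ _
    rfl
  exact h2 _ _ (funext fun x => propext (this x)) _ _ _ _

/-! ### Isomorphisms of representatives are compatible with grafting and restriction -/

/-- An isomorphism acts on the children of the root. -/
def childEquiv {T S : RTree} (φ : T.carrier ≃o S.carrier) : T.RootChild ≃ S.RootChild where
  toFun c := ⟨φ c.1, by simpa using (apply_covBy_apply_iff φ (a := ⊥)).2 c.2⟩
  invFun c := ⟨φ.symm c.1, by simpa using (apply_covBy_apply_iff φ.symm (a := ⊥)).2 c.2⟩
  left_inv c := by simp
  right_inv c := by simp

/-- Grafting along corresponding grafting maps gives isomorphic trees. -/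
def graftIso {T T' S S' : RTree} (φ : T.carrier ≃o T'.carrier) (ψ : S.carrier ≃o S'.carrier)
    (d : T.RootChild → S.carrier) (d' : T'.RootChild → S'.carrier)
    (h : ∀ c, d' (childEquiv φ c) = ψ (d c)) : (graft d).carrier ≃o (graft d').carrier where
  toEquiv := Equiv.sumCongr (vertIso φ).toEquiv ψ.toEquiv
  map_rel_iff' := by
    intro x y
    change GraftCarrier.le d' _ _ ↔ GraftCarrier.le d x y
    rcases x with a | s <;> rcases y with b | s'
    · exact φ.le_iff_le
    · exact Iff.rfl
    · constructor
      · rintro ⟨c, hc, hs⟩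
        obtain ⟨c, rfl⟩ := (childEquiv φ).surjective c
        refine ⟨c, φ.le_iff_le.1 hc, ?_⟩
        rw [h] at hs
        exact ψ.le_iff_le.1 hs
      · rintro ⟨c, hc, hs⟩
        refine ⟨childEquiv φ c, φ.le_iff_le.2 hc, ?_⟩
        rw [h]
        exact ψ.le_iff_le.2 hs
    · exact ψ.le_iff_le

/-- Corresponding restrictions of isomorphic trees are isomorphic. -/
def restrictIso {T S : RTree} (φ : T.carrier ≃o S.carrier) (U : Set T.carrier)
    (U' : Set S.carrier) (h : ∀ x, φ x ∈ U' ↔ x ∈ U) :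
    (T.restrict U).carrier ≃o (S.restrict U').carrier where
  toEquiv := φ.toEquiv.subtypeEquiv fun x => by simp [h]
  map_rel_iff' := φ.le_iff_le

end RTree

/-- The set of non-planar rooted trees. -/
def NPTree : Type 1 := Quotient RTree.setoid

noncomputable instance : DecidableEq NPTree := Classical.decEq _

/-- The degree of a tree: the number of its non-root vertices. -/
noncomputable def NPTree.degree : NPTree → ℕ :=
  Quotient.lift (fun T : RTree => Nat.card T.Vert) fun _ _ ⟨φ⟩ =>
    Nat.card_congr (RTree.vertIso φ).toEquiv

/-- A fixed representative of each tree. -/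
noncomputable def NPTree.rep (t : NPTree) : RTree := Quotient.out t

/-- The tree represented by `T`. -/
def RTree.toTree (T : RTree) : NPTree := Quotient.mk _ T

/-- An isomorphism between `T` and the fixed representative of its tree. -/
noncomputable def RTree.toRep (T : RTree) : T.carrier ≃o T.toTree.rep.carrier :=
  (Classical.choice (Quotient.mk_out T)).symm

/-! ### Tensor powers indexed by trees -/

namespace RTree

variable (V : Type u) [AddCommGroup V] [Module ℝ V]

/-- The tensor power of `V` with one factor for each non-root vertex of `T`; an elementary tensor
is a labelling of the non-root vertices. -/
abbrev Tens (T : RTree) : Type u := ⨂[ℝ] _ : T.Vert, V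

variable {V}

/-- Relabelling of tensors along a bijection of the non-root vertices. -/
noncomputable def relabel {T S : RTree} (e : T.Vert ≃ S.Vert) : T.Tens V ≃ₗ[ℝ] S.Tens V :=
  PiTensorProduct.reindex ℝ (fun _ => V) e

@[simp] theorem relabel_tprod {T S : RTree} (e : T.Vert ≃ S.Vert) (l : T.Vert → V) :
    relabel e (PiTensorProduct.tprod ℝ l) = PiTensorProduct.tprod ℝ fun x => l (e.symm x) :=
  PiTensorProduct.reindex_tprod _ _

theorem relabel_relabel {T S R : RTree} (e : T.Vert ≃ S.Vert) (f : S.Vert ≃ R.Vert)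
    (x : T.Tens V) : relabel f (relabel e x) = relabel (e.trans f) x := by
  induction x using PiTensorProduct.induction_on with
  | smul_tprod r l => simp
  | add x y hx hy => simp [hx, hy]

theorem relabel_refl {T : RTree} (x : T.Tens V) : relabel (Equiv.refl T.Vert) x = x := by
  induction x using PiTensorProduct.induction_on with
  | smul_tprod r l => simp
  | add x y hx hy => simp [hx, hy]

variable (V) in
/-- The symmetrization over the symmetry group of `T`. -/
noncomputable def sym (T : RTree) : T.Tens V →ₗ[ℝ] T.Tens V :=
  (1 / (Fintype.card T.SG : ℝ)) • ∑ σ : T.SG, (relabel σ.toEquiv).toLinearMap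

theorem ker_sym_le {M : Type*} [AddCommGroup M] [Module ℝ M] {T : RTree} (f : T.Tens V →ₗ[ℝ] M)
    (h : ∀ (σ : T.SG) (x : T.Tens V), f (relabel σ.toEquiv x) = f x) :
    LinearMap.ker (T.sym V) ≤ LinearMap.ker f := by
  intro x hx
  have h0 : (Fintype.card T.SG : ℝ) ≠ 0 := by
    exact_mod_cast (Fintype.card_pos (α := T.SG)).ne'
  have : f (T.sym V x) = f x := by
    simp only [sym, LinearMap.smul_apply, LinearMap.sum_apply, map_smul, map_sum,
      LinearEquiv.coe_coe, h]
    rw [Finset.sum_const, Finset.card_univ, ← Nat.cast_smul_eq_nsmul ℝ, smul_smul,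
      one_div, inv_mul_cancel₀ h0, one_smul]
  rw [LinearMap.mem_ker] at hx ⊢
  rw [← this, hx, map_zero]

theorem sym_relabel {T : RTree} (σ : T.SG) (x : T.Tens V) :
    T.sym V (relabel σ.toEquiv x) = T.sym V x := by
  simp only [sym, LinearMap.smul_apply, LinearMap.sum_apply, LinearEquiv.coe_coe, relabel_relabel]
  congr 1
  exact Fintype.sum_equiv
    (Equiv.mk (fun τ : T.SG => σ.trans τ) (fun τ => σ.symm.trans τ)
      (fun τ => by ext; simp) (fun τ => by ext; simp)) _ _ fun τ => rfl

end RTree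

section

variable (V : Type u) [AddCommGroup V] [Module ℝ V]

/-- The tensor power of `V` indexed by the tree `t`. -/
abbrev TreePower (t : NPTree) : Type u := t.rep.Tens V ⧸ LinearMap.ker (t.rep.sym V)

/-- The tree space over `V`. -/
def TreeSpace : Type (max 1 u) := ⨁ t : NPTree, TreePower V t

noncomputable instance : AddCommGroup (TreeSpace V) :=
  inferInstanceAs (AddCommGroup (⨁ t : NPTree, TreePower V t))

noncomputable instance : Module ℝ (TreeSpace V) :=
  inferInstanceAs (Module ℝ (⨁ t : NPTree, TreePower V t))

/-- The inclusion of a summand. -/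
noncomputable def TreeSpace.of (t : NPTree) : TreePower V t →ₗ[ℝ] TreeSpace V :=
  DirectSum.lof ℝ NPTree (TreePower V) t

variable {V}

/-- The element of the tree space represented by a tensor on some representative `T` of a tree. -/
noncomputable def RTree.cls (T : RTree) : T.Tens V →ₗ[ℝ] TreeSpace V :=
  TreeSpace.of V T.toTree ∘ₗ
    (LinearMap.ker (T.toTree.rep.sym V)).mkQ ∘ₗ
      (RTree.relabel (RTree.vertIso T.toRep).toEquiv).toLinearMap

/-- `T.cls` does not depend on the isomorphism to the fixed representative. -/
theorem RTree.cls_eq (T : RTree) (t : NPTree) (φ : T.carrier ≃o t.rep.carrier) (x : T.Tens V) :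
    T.cls x = TreeSpace.of V t
      (Submodule.Quotient.mk (RTree.relabel (RTree.vertIso φ).toEquiv x)) := by
  have ht : T.toTree = t := by
    rw [← Quotient.out_eq t]
    exact Quotient.sound ⟨φ⟩
  subst ht
  simp only [RTree.cls, LinearMap.comp_apply, LinearEquiv.coe_coe, Submodule.mkQ_apply]
  congr 1
  rw [Submodule.Quotient.eq, LinearMap.mem_ker, map_sub, sub_eq_zero]
  rw [← RTree.sym_relabel (RTree.vertIso (T.toRep.symm.trans φ)) (RTree.relabel _ x),
    RTree.relabel_relabel]
  refine congrArg (T.toTree.rep.sym V) (congrArg (fun e => RTree.relabel e x) ?_)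
  refine Equiv.ext fun y => Subtype.ext ?_
  simp [RTree.vertIso]

/-- `T.cls` does not depend on the representative `T`. -/
theorem RTree.cls_relabel {T S : RTree} (φ : T.carrier ≃o S.carrier) (x : T.Tens V) :
    S.cls (RTree.relabel (RTree.vertIso φ).toEquiv x) = T.cls x := by
  rw [S.cls_eq S.toTree S.toRep, T.cls_eq S.toTree (φ.trans S.toRep), RTree.relabel_relabel]
  rfl

theorem NPTree.cls_rep (t : NPTree) (x : t.rep.Tens V) :
    t.rep.cls x = TreeSpace.of V t (Submodule.Quotient.mk x) := by
  rw [t.rep.cls_eq t (OrderIso.refl _)]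
  congr 2
  exact RTree.relabel_refl x

namespace TreeSpace

/-- The linear extension of a map that is given on tensors on representatives and that does not
depend on the representative. -/
noncomputable def extend {M : Type*} [AddCommGroup M] [Module ℝ M]
    (f : ∀ T : RTree, T.Tens V →ₗ[ℝ] M)
    (h : ∀ (T S : RTree) (φ : T.carrier ≃o S.carrier) (x : T.Tens V),
      f S (RTree.relabel (RTree.vertIso φ).toEquiv x) = f T x) : TreeSpace V →ₗ[ℝ] M :=
  DirectSum.toModule ℝ NPTree M fun t =>
    (LinearMap.ker (t.rep.sym V)).liftQ (f t.rep) (RTree.ker_sym_le _ fun σ x => by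
      obtain ⟨φ, rfl⟩ := RTree.exists_vertIso_eq σ
      exact h _ _ φ x)

theorem extend_cls {M : Type*} [AddCommGroup M] [Module ℝ M]
    (f : ∀ T : RTree, T.Tens V →ₗ[ℝ] M)
    (h : ∀ (T S : RTree) (φ : T.carrier ≃o S.carrier) (x : T.Tens V),
      f S (RTree.relabel (RTree.vertIso φ).toEquiv x) = f T x) (T : RTree) (x : T.Tens V) :
    extend f h (T.cls x) = f T x := by
  refine Eq.trans ?_ (h _ _ T.toRep x)
  exact DirectSum.toModule_lof ℝ T.toTree _

/-- Linear maps on the tree space are determined by their values on elementary labelled trees. -/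
theorem hom_ext {M : Type*} [AddCommGroup M] [Module ℝ M] {f g : TreeSpace V →ₗ[ℝ] M}
    (h : ∀ (T : RTree) (l : T.Vert → V),
      f (T.cls (PiTensorProduct.tprod ℝ l)) = g (T.cls (PiTensorProduct.tprod ℝ l))) : f = g := by
  refine DirectSum.linearMap_ext (M := TreePower V) ℝ fun t => Submodule.linearMap_qext _ ?_
  refine PiTensorProduct.ext (MultilinearMap.ext fun l => ?_)
  have := h t.rep l
  rw [NPTree.cls_rep] at this
  exact this

end TreeSpace

/-! ### Grafting and cutting of labelled representatives -/

namespace RTree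

/-- The labelled version of grafting: every vertex keeps its label. -/
noncomputable def graftTens {T S : RTree} (d : T.RootChild → S.carrier) :
    T.Tens V →ₗ[ℝ] S.Tens V →ₗ[ℝ] (graft d).Tens V :=
  (TensorProduct.mk ℝ (T.Tens V) (S.Tens V)).compr₂
    ((PiTensorProduct.reindex ℝ (fun _ => V) (graftVert d)).toLinearMap ∘ₗ
      (PiTensorProduct.tmulEquiv ℝ V).toLinearMap)

theorem graftTens_tprod {T S : RTree} (d : T.RootChild → S.carrier) (l : T.Vert → V)
    (m : S.Vert → V) :
    graftTens d (PiTensorProduct.tprod ℝ l) (PiTensorProduct.tprod ℝ m) =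
      PiTensorProduct.tprod ℝ fun x => Sum.elim l m ((graftVert d).symm x) := by
  simp [graftTens]

/-- The labelled version of splitting the vertices of a tree into those in `U` and the others:
every vertex keeps its label. -/
noncomputable def splitTens (T : RTree) (U : Set T.carrier) :
    T.Tens V →ₗ[ℝ] (T.restrict U).Tens V ⊗[ℝ] (T.restrict Uᶜ).Tens V :=
  (PiTensorProduct.tmulEquiv ℝ V).symm.toLinearMap ∘ₗ
    (PiTensorProduct.reindex ℝ (fun _ => V) (T.restrictVert U).symm).toLinearMap

theorem splitTens_tprod (T : RTree) (U : Set T.carrier) (l : T.Vert → V) :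
    T.splitTens U (PiTensorProduct.tprod ℝ l) =
      (PiTensorProduct.tprod ℝ fun a => l (T.restrictVert U (.inl a))) ⊗ₜ[ℝ]
        (PiTensorProduct.tprod ℝ fun a => l (T.restrictVert U (.inr a))) := by
  simp [splitTens]

theorem cls_graft_relabel {T T' S S' : RTree} (φ : T.carrier ≃o T'.carrier)
    (ψ : S.carrier ≃o S'.carrier) (d : T.RootChild → S.carrier) (d' : T'.RootChild → S'.carrier)
    (h : ∀ c, d' (childEquiv φ c) = ψ (d c)) (x : T.Tens V) (y : S.Tens V) :
    (graft d').cls (graftTens d' (relabel (vertIso φ).toEquiv x)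
      (relabel (vertIso ψ).toEquiv y)) = (graft d).cls (graftTens d x y) := by
  rw [← cls_relabel (graftIso φ ψ d d' h)]
  congr 1
  induction x using PiTensorProduct.induction_on with
  | add x x' hx hx' => simp [hx, hx']
  | smul_tprod r l =>
    induction y using PiTensorProduct.induction_on with
    | add y y' hy hy' => simp only [map_add, hy, hy']
    | smul_tprod r' m =>
      simp only [map_smul, LinearMap.smul_apply, relabel_tprod, graftTens_tprod]
      congr 3
      funext z
      obtain ⟨z, rfl⟩ := (graftVert d').surjective z
      rcases z with a | s
      · simp only [Equiv.symm_apply_apply, Sum.elim_inl]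
        rfl
      · simp only [Equiv.symm_apply_apply, Sum.elim_inr]
        rfl

/-- The tensor product of the two parts into which the vertex set `U` divides a labelled tree. -/
noncomputable def splitCls (T : RTree) (U : Set T.carrier) :
    T.Tens V →ₗ[ℝ] TreeSpace V ⊗[ℝ] TreeSpace V :=
  TensorProduct.map (T.restrict U).cls (T.restrict Uᶜ).cls ∘ₗ T.splitTens U

theorem splitCls_relabel {T S : RTree} (φ : T.carrier ≃o S.carrier) (U : Set T.carrier)
    (U' : Set S.carrier) (h : ∀ x, φ x ∈ U' ↔ x ∈ U) (x : T.Tens V) :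
    S.splitCls U' (relabel (vertIso φ).toEquiv x) = T.splitCls U x := by
  have hc : ∀ x, φ x ∈ U'ᶜ ↔ x ∈ Uᶜ := fun x => not_congr (h x)
  induction x using PiTensorProduct.induction_on with
  | add x y hx hy => simp [hx, hy]
  | smul_tprod r l =>
    simp only [splitCls, map_smul, LinearMap.comp_apply, relabel_tprod, splitTens_tprod,
      TensorProduct.map_tmul]
    rw [← cls_relabel (restrictIso φ U U' h), ← cls_relabel (restrictIso φ Uᶜ U'ᶜ hc),
      relabel_tprod, relabel_tprod]
    rfl

end RTree

/-! ### The operations on the tree space -/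

namespace TreeSpace

noncomputable instance (T S : RTree) : Fintype (T.RootChild → S.carrier) := Fintype.ofFinite _

noncomputable instance (T : RTree) : Fintype T.Cut := Fintype.ofFinite _

noncomputable instance (T : RTree) : Fintype (Set T.RootChild) := Fintype.ofFinite _

/-- The grafting product of two tensors on representatives: the sum over all grafting maps. -/
noncomputable def preStar (T S : RTree) : T.Tens V →ₗ[ℝ] S.Tens V →ₗ[ℝ] TreeSpace V :=
  ∑ d : T.RootChild → S.carrier, (RTree.graftTens d).compr₂ (RTree.graft d).cls

theorem preStar_relabel {T T' S S' : RTree} (φ : T.carrier ≃o T'.carrier)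
    (ψ : S.carrier ≃o S'.carrier) (x : T.Tens V) (y : S.Tens V) :
    preStar T' S' (RTree.relabel (RTree.vertIso φ).toEquiv x)
      (RTree.relabel (RTree.vertIso ψ).toEquiv y) = preStar T S x y := by
  simp only [preStar, LinearMap.sum_apply, LinearMap.compr₂_apply]
  refine (Fintype.sum_equiv (Equiv.arrowCongr (RTree.childEquiv φ) ψ.toEquiv) _ _ fun d => ?_).symm
  refine (RTree.cls_graft_relabel φ ψ d _ (fun c => ?_) x y).symm
  simp

/-- The root-merging product of two tensors on representatives. -/
noncomputable def preCirc (T S : RTree) : T.Tens V →ₗ[ℝ] S.Tens V →ₗ[ℝ] TreeSpace V :=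
  (RTree.graftTens _).compr₂ (RTree.merge T S).cls

theorem preCirc_relabel {T T' S S' : RTree} (φ : T.carrier ≃o T'.carrier)
    (ψ : S.carrier ≃o S'.carrier) (x : T.Tens V) (y : S.Tens V) :
    preCirc T' S' (RTree.relabel (RTree.vertIso φ).toEquiv x)
      (RTree.relabel (RTree.vertIso ψ).toEquiv y) = preCirc T S x y :=
  RTree.cls_graft_relabel φ ψ _ _ (fun _ => by simp) x y

/-- The bilinear extension of a map that is given on tensors on representatives and that does not
depend on the representatives. -/
noncomputable def extend₂ (f : ∀ T S : RTree, T.Tens V →ₗ[ℝ] S.Tens V →ₗ[ℝ] TreeSpace V)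
    (h : ∀ (T T' S S' : RTree) (φ : T.carrier ≃o T'.carrier) (ψ : S.carrier ≃o S'.carrier)
      (x : T.Tens V) (y : S.Tens V), f T' S' (RTree.relabel (RTree.vertIso φ).toEquiv x)
        (RTree.relabel (RTree.vertIso ψ).toEquiv y) = f T S x y) :
    TreeSpace V →ₗ[ℝ] TreeSpace V →ₗ[ℝ] TreeSpace V :=
  have hr : ∀ (T S S' : RTree) (ψ : S.carrier ≃o S'.carrier) (x : T.Tens V) (y : S.Tens V),
      f T S' x (RTree.relabel (RTree.vertIso ψ).toEquiv y) = f T S x y := fun T S S' ψ x y => by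
    have := h T T S S' (OrderIso.refl _) ψ x y
    rwa [show RTree.relabel (RTree.vertIso (OrderIso.refl T.carrier)).toEquiv x = x from
      RTree.relabel_refl x] at this
  extend (M := TreeSpace V →ₗ[ℝ] TreeSpace V)
    (fun T => (extend (M := T.Tens V →ₗ[ℝ] TreeSpace V) (fun S => (f T S).flip)
      fun S S' ψ y => LinearMap.ext fun x => hr T S S' ψ x y).flip)
    fun T T' φ x => hom_ext fun S l => by
      rw [LinearMap.flip_apply, LinearMap.flip_apply, extend_cls, extend_cls, LinearMap.flip_apply,
        LinearMap.flip_apply, ← h T T' S S φ (OrderIso.refl _)]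
      exact congrArg _ (RTree.relabel_refl (T := S) _).symm

theorem extend₂_cls (f : ∀ T S : RTree, T.Tens V →ₗ[ℝ] S.Tens V →ₗ[ℝ] TreeSpace V)
    (h : ∀ (T T' S S' : RTree) (φ : T.carrier ≃o T'.carrier) (ψ : S.carrier ≃o S'.carrier)
      (x : T.Tens V) (y : S.Tens V), f T' S' (RTree.relabel (RTree.vertIso φ).toEquiv x)
        (RTree.relabel (RTree.vertIso ψ).toEquiv y) = f T S x y) (T S : RTree) (x : T.Tens V)
    (y : S.Tens V) : extend₂ f h (T.cls x) (S.cls y) = f T S x y := by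
  rw [extend₂, extend_cls, LinearMap.flip_apply, extend_cls, LinearMap.flip_apply]

variable (V)

/-- The grafting product. -/
noncomputable def star : TreeSpace V →ₗ[ℝ] TreeSpace V →ₗ[ℝ] TreeSpace V :=
  extend₂ preStar fun _ _ _ _ => preStar_relabel

/-- The root-merging product. -/
noncomputable def circ : TreeSpace V →ₗ[ℝ] TreeSpace V →ₗ[ℝ] TreeSpace V :=
  extend₂ preCirc fun _ _ _ _ => preCirc_relabel

/-- The coproduct that distributes the branches of the root in all possible ways: for a set `I`
of children of the root, the first factor is the root-merging of the branches in `I`, and the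
second one (see `RTree.restrict_branches_compl`) that of the branches outside `I`. -/
noncomputable def deltaGL : TreeSpace V →ₗ[ℝ] TreeSpace V ⊗[ℝ] TreeSpace V :=
  extend (fun T => ∑ I : Set T.RootChild, T.splitCls (T.branches I)) fun T S φ x => by
    simp only [LinearMap.sum_apply]
    refine (Fintype.sum_equiv (Equiv.Set.congr (RTree.childEquiv φ)) _ _ fun I => ?_).symm
    refine (RTree.splitCls_relabel φ _ _ (fun y => ?_) x).symm
    constructor
    · rintro ⟨_, ⟨_, ⟨c, hc, rfl⟩, rfl⟩, hle⟩
      exact ⟨c.1, ⟨c, hc, rfl⟩, φ.le_iff_le.1 hle⟩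
    · rintro ⟨_, ⟨c, hc, rfl⟩, hle⟩
      exact ⟨_, ⟨_, ⟨c, hc, rfl⟩, rfl⟩, φ.le_iff_le.2 hle⟩

/-- The admissible-cut coproduct: for an admissible cut `C`, the first factor consists of the root
and the vertices weakly above `C`, the second one of all the other vertices. -/
noncomputable def deltaCK : TreeSpace V →ₗ[ℝ] TreeSpace V ⊗[ℝ] TreeSpace V :=
  extend (fun T => ∑ C : T.Cut, T.splitCls (T.above C.1)) fun T S φ x => by
    simp only [LinearMap.sum_apply]
    have hcut : ∀ C : Set T.carrier, ((⊥ : T.carrier) ∉ C ∧ IsAntichain (· ≤ ·) C) ↔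
        ((⊥ : S.carrier) ∉ Equiv.Set.congr φ.toEquiv C ∧
          IsAntichain (· ≤ ·) (Equiv.Set.congr φ.toEquiv C)) := by
      intro C
      refine and_congr (not_congr ?_) ?_
      · constructor
        · exact fun h => ⟨⊥, h, by simp⟩
        · rintro ⟨b, hb, h⟩
          have : b = ⊥ := by simpa using h
          exact this ▸ hb
      · exact (IsAntichain.image_iso_iff (φ := φ)).symm
    refine (Fintype.sum_equiv ((Equiv.Set.congr φ.toEquiv).subtypeEquiv hcut) _ _
      fun C => ?_).symm
    refine (RTree.splitCls_relabel φ _ _ (fun y => ?_) x).symm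
    constructor
    · rintro ⟨_, ⟨c, hc, rfl⟩, hle⟩
      exact ⟨c, hc, φ.le_iff_le.1 hle⟩
    · rintro ⟨c, hc, hle⟩
      exact ⟨_, ⟨c, hc, rfl⟩, φ.le_iff_le.2 hle⟩

variable {V}

/-- The grafting product of labelled trees in terms of arbitrary representatives. -/
theorem star_cls (T S : RTree) (x : T.Tens V) (y : S.Tens V) :
    star V (T.cls x) (S.cls y) =
      ∑ d : T.RootChild → S.carrier, (RTree.graft d).cls (RTree.graftTens d x y) := by
  rw [star, extend₂_cls]
  simp [preStar]

/-- The root-merging product of labelled trees in terms of arbitrary representatives. -/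
theorem circ_cls (T S : RTree) (x : T.Tens V) (y : S.Tens V) :
    circ V (T.cls x) (S.cls y) = (RTree.merge T S).cls (RTree.graftTens _ x y) := by
  rw [circ, extend₂_cls]
  rfl

theorem deltaGL_cls (T : RTree) (x : T.Tens V) :
    deltaGL V (T.cls x) = ∑ I : Set T.RootChild, T.splitCls (T.branches I) x := by
  rw [deltaGL, extend_cls, LinearMap.sum_apply]

theorem deltaCK_cls (T : RTree) (x : T.Tens V) :
    deltaCK V (T.cls x) = ∑ C : T.Cut, T.splitCls (T.above C.1) x := by
  rw [deltaCK, extend_cls, LinearMap.sum_apply]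

variable (V)

/-- The tree with only a root, as an element of the tree space. -/
noncomputable def one : TreeSpace V :=
  RTree.single.cls (PiTensorProduct.tprod ℝ fun _ => 0)

/-- The unit map. -/
noncomputable def eta : ℝ →ₗ[ℝ] TreeSpace V := LinearMap.toSpanSingleton ℝ _ (one V)

open scoped Classical in
/-- The counit: the coefficient of the tree with only a root. -/
noncomputable def epsilon : TreeSpace V →ₗ[ℝ] ℝ :=
  extend (fun T => if _h : IsEmpty T.Vert then
      (PiTensorProduct.isEmptyEquiv T.Vert : T.Tens V ≃ₗ[ℝ] ℝ).toLinearMap else 0) fun T S φ x => by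
    by_cases h : IsEmpty T.Vert
    · have h' : IsEmpty S.Vert := (RTree.vertIso φ).symm.toEquiv.isEmpty
      induction x using PiTensorProduct.induction_on with
      | add x y hx hy => simp only [map_add, hx, hy]
      | smul_tprod r l => simp [h, h']
    · have h' : ¬ IsEmpty S.Vert := fun h' => h (RTree.vertIso φ).toEquiv.isEmpty
      simp [h, h']

/-- The homogeneous part of degree `k`: the direct sum of the tensor powers of `V` indexed by the
trees of degree `k`. -/
noncomputable def homogeneous (k : ℕ) : Submodule ℝ (TreeSpace V) :=
  ⨆ (t : NPTree) (_ : t.degree = k), LinearMap.range (of V t)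

end TreeSpace

end

/-! ### Graded connected Hopf algebras -/

section

variable {A : Type w} [AddCommGroup A] [Module ℝ A]

/-- The vector space `A` with the given multiplication, unit, comultiplication and counit is a Hopf
algebra (in particular a bialgebra): the four maps are the structure maps of a Hopf algebra,
transported along a linear isomorphism. -/
def IsHopfAlgebra (mul : A →ₗ[ℝ] A →ₗ[ℝ] A) (unit : ℝ →ₗ[ℝ] A) (comul : A →ₗ[ℝ] A ⊗[ℝ] A)
    (counit : A →ₗ[ℝ] ℝ) : Prop :=
  ∃ (H : Type w) (_ : Ring H) (_ : HopfAlgebra ℝ H) (e : A ≃ₗ[ℝ] H),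
    (∀ x y, e (mul x y) = e x * e y) ∧
    (∀ r, e (unit r) = algebraMap ℝ H r) ∧
    (∀ x, TensorProduct.map e.toLinearMap e.toLinearMap (comul x) = Coalgebra.comul (e x)) ∧
    (∀ x, counit x = Coalgebra.counit (R := ℝ) (e x))

/-- The subspaces `𝒜 n` form a grading of `A` that is connected and for which the given
multiplication, unit, comultiplication and counit are homogeneous of degree zero. -/
structure IsConnectedGrading (𝒜 : ℕ → Submodule ℝ A) (mul : A →ₗ[ℝ] A →ₗ[ℝ] A)
    (unit : ℝ →ₗ[ℝ] A) (comul : A →ₗ[ℝ] A ⊗[ℝ] A) (counit : A →ₗ[ℝ] ℝ) : Prop where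
  isInternal : DirectSum.IsInternal 𝒜
  mul_mem : ∀ i j x y, x ∈ 𝒜 i → y ∈ 𝒜 j → mul x y ∈ 𝒜 (i + j)
  comul_mem : ∀ n x, x ∈ 𝒜 n → comul x ∈
    ⨆ (i : ℕ) (j : ℕ) (_ : i + j = n),
      LinearMap.range (TensorProduct.map (𝒜 i).subtype (𝒜 j).subtype)
  counit_eq_zero : ∀ n x, n ≠ 0 → x ∈ 𝒜 n → counit x = 0
  unit_injective : Function.Injective unit
  range_unit : LinearMap.range unit = 𝒜 0

end

/-! ### Antipode of a connected graded bialgebra -/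

section

open WithConv

variable {A : Type w}

/-! Labelled trees are moved into one ambient finite set `X` carrying a relation `r` and labels `l`.
A subset `A` then stands for the labelled tree `forest r l A` whose non-root vertices are the
elements of `A`, with value `0` when `r` is not a forest order on `A`. In this language all four
operations are sums over sets of combinatorial data restricted only by conditions on pairs of
elements.

A product of `A` and `B` sums over the relations `R` that agree with `r` except between `A` and `B`.
For `star` no element of `A` may lie below an element of `B` (`star_forest`); for `circ` the two
sets are incomparable (`circ_forest`). A coproduct of `A` sums over subsets `U` of `A`. For
`deltaCK` no element of `U` lies below an element of `A \ U` (`deltaCK_forest`); for `deltaGL` the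
two sets are incomparable (`deltaGL_forest`). Thus the same two conditions, `NotBelow` and
`Incomparable`, occur with exchanged roles, and both bialgebras are treated at once.

Since the conditions are pairwise, each side of associativity runs over relations on three sets
(`IsExtension₃`), and each side of coassociativity over ordered partitions into three blocks
(`sum_cuts_cuts`). For the compatibility of product and coproduct, cutting an extension divides `A ∪
B` into four blocks. Between diagonally opposite blocks both conditions apply, and as one of them is
incomparability, no relation remains there. The relation is therefore the same datum as two
extensions, one on the part cut off and one on the rest (`IsDual.sum_extensions_cuts`).

The degree is the cardinality of `A`, so all maps are visibly homogeneous and degree `0` is spanned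
by the empty forest. Connectedness then yields the antipode as a geometric series for convolution
(`exists_antipode`). -/

theorem eq_of_mem_iSup_range_map {A M : Type*} [AddCommGroup A] [Module ℝ A] [AddCommGroup M]
    [Module ℝ M] (𝒜 : ℕ → Submodule ℝ A) {F G : A ⊗[ℝ] A →ₗ[ℝ] M} {n : ℕ}
    (h : ∀ i j, i + j = n → ∀ x ∈ 𝒜 i, ∀ y ∈ 𝒜 j, F (x ⊗ₜ y) = G (x ⊗ₜ y)) {z : A ⊗[ℝ] A}
    (hz : z ∈ ⨆ (i : ℕ) (j : ℕ) (_ : i + j = n),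
      LinearMap.range (TensorProduct.map (𝒜 i).subtype (𝒜 j).subtype)) : F z = G z := by
  suffices (⨆ (i : ℕ) (j : ℕ) (_ : i + j = n),
      LinearMap.range (TensorProduct.map (𝒜 i).subtype (𝒜 j).subtype)) ≤
        LinearMap.eqLocus F G from this hz
  refine iSup_le fun i => iSup_le fun j => iSup_le fun hij => ?_
  rintro _ ⟨t, rfl⟩
  induction t using TensorProduct.induction_on with
  | zero => simp
  | tmul x y => exact h i j hij x x.2 y y.2
  | add x y hx hy => rw [map_add]; exact add_mem hx hy

/-- A connected graded bialgebra has an antipode. -/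
theorem exists_antipode [Ring A] [Bialgebra ℝ A] (𝒜 : ℕ → Submodule ℝ A)
    (hint : DirectSum.IsInternal 𝒜)
    (hcomul : ∀ n x, x ∈ 𝒜 n → Coalgebra.comul (R := ℝ) x ∈
      ⨆ (i : ℕ) (j : ℕ) (_ : i + j = n),
        LinearMap.range (TensorProduct.map (𝒜 i).subtype (𝒜 j).subtype))
    (h0 : 𝒜 0 ≤ LinearMap.range (Algebra.linearMap ℝ A)) :
    ∃ S : A →ₗ[ℝ] A,
      LinearMap.mul' ℝ A ∘ₗ S.rTensor A ∘ₗ Coalgebra.comul =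
        Algebra.linearMap ℝ A ∘ₗ Coalgebra.counit ∧
      LinearMap.mul' ℝ A ∘ₗ S.lTensor A ∘ₗ Coalgebra.comul =
        Algebra.linearMap ℝ A ∘ₗ Coalgebra.counit := by
  -- In the convolution algebra the identity is `1 - f`, so the antipode, its inverse, should be the
  -- sum of all powers of `f`. As `f` vanishes in degree `0`, its power `f ^ k` vanishes in all
  -- degrees below `k`, and the series is finite on each degree.
  let f : WithConv (A →ₗ[ℝ] A) := 1 - toConv LinearMap.id
  have hf0 : ∀ x ∈ 𝒜 0, f.ofConv x = 0 := by
    intro x hx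
    obtain ⟨r, rfl⟩ := h0 hx
    simp [f, LinearMap.convOne_def]
  have hpow : ∀ k n x, n < k → x ∈ 𝒜 n → (f ^ k).ofConv x = 0 := by
    intro k
    induction k with
    | zero => intro n x h; omega
    | succ k ih =>
      intro n x hn hx
      rw [pow_succ']
      refine eq_of_mem_iSup_range_map 𝒜 (G := 0)
        (F := LinearMap.mul' ℝ A ∘ₗ TensorProduct.map f.ofConv (f ^ k).ofConv) ?_ (hcomul n x hx)
      intro i j hij y hy z hz
      simp only [LinearMap.comp_apply, TensorProduct.map_tmul, LinearMap.mul'_apply,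
        LinearMap.zero_apply]
      -- Either the left factor has degree `0` and `f` kills it, or the right factor has degree `j <
      -- k` and `f ^ k` kills it.
      rcases Nat.eq_zero_or_pos i with rfl | hi
      · rw [hf0 y hy, zero_mul]
      · rw [ih j z (by omega) hz, mul_zero]
  -- In degree `n` the powers beyond `n` contribute nothing, so the partial sums are stable there
  -- and glue to `S`.
  let g : ℕ → WithConv (A →ₗ[ℝ] A) := fun n => ∑ k ∈ Finset.range (n + 1), f ^ k
  have hg : ∀ n m x, x ∈ 𝒜 n → n ≤ m → (g m).ofConv x = (g n).ofConv x := by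
    intro n m x hx hnm
    induction m, hnm using Nat.le_induction with
    | base => rfl
    | succ m hm ih =>
      have : g (m + 1) = g m + f ^ (m + 1) := Finset.sum_range_succ _ _
      rw [this, ofConv_add, LinearMap.add_apply, ih, hpow _ n x (by omega) hx, add_zero]
  let E := LinearEquiv.ofBijective (DirectSum.coeLinearMap 𝒜) hint
  let S : A →ₗ[ℝ] A :=
    DirectSum.toModule ℝ ℕ A (fun n => (g n).ofConv ∘ₗ (𝒜 n).subtype) ∘ₗ E.symm.toLinearMap
  have hS : ∀ n x, x ∈ 𝒜 n → S x = (g n).ofConv x := by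
    intro n x hx
    have : E.symm x = DirectSum.lof ℝ ℕ (fun i => 𝒜 i) n ⟨x, hx⟩ := by
      rw [LinearEquiv.symm_apply_eq]
      exact (DirectSum.coeLinearMap_lof 𝒜 n ⟨x, hx⟩).symm
    simp only [S, LinearMap.comp_apply, LinearEquiv.coe_coe, this, DirectSum.toModule_lof]
    rfl
  have hext : ∀ {F G : A →ₗ[ℝ] A}, (∀ n, ∀ x ∈ 𝒜 n, F x = G x) → F = G := by
    intro F G h
    have : ⨆ n, 𝒜 n ≤ LinearMap.eqLocus F G := iSup_le fun n x hx => h n x hx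
    rw [hint.submodule_iSup_eq_top] at this
    exact LinearMap.ext fun x => this trivial
  have hid : toConv LinearMap.id = 1 - f := by simp [f]
  refine ⟨S, hext fun n x hx => ?_, hext fun n x hx => ?_⟩
  -- The geometric sum telescopes to `1 - f ^ (n + 1)`, whose second term vanishes in degree `n`.
  -- All left factors of the coproduct have degree at most `n`, so there `S` may be replaced by `g
  -- n`.
  · have h1 : g n * toConv LinearMap.id = 1 - f ^ (n + 1) := by
      rw [hid]; exact geom_sum_mul_neg f (n + 1)
    have h2 := congrArg (fun F : WithConv (A →ₗ[ℝ] A) => F.ofConv x) h1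
    simp only [ofConv_sub, LinearMap.sub_apply, hpow _ n x (Nat.lt_succ_self n) hx, sub_zero] at h2
    refine Eq.trans ?_ h2
    refine eq_of_mem_iSup_range_map 𝒜 (F := LinearMap.mul' ℝ A ∘ₗ S.rTensor A)
      (G := LinearMap.mul' ℝ A ∘ₗ TensorProduct.map (g n).ofConv LinearMap.id) ?_ (hcomul n x hx)
    intro i j hij y hy z hz
    simp [hS i y hy, hg i n y hy (by omega)]
  · have h1 : toConv LinearMap.id * g n = 1 - f ^ (n + 1) := by
      rw [hid]; exact mul_neg_geom_sum f (n + 1)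
    have h2 := congrArg (fun F : WithConv (A →ₗ[ℝ] A) => F.ofConv x) h1
    simp only [ofConv_sub, LinearMap.sub_apply, hpow _ n x (Nat.lt_succ_self n) hx, sub_zero] at h2
    refine Eq.trans ?_ h2
    refine eq_of_mem_iSup_range_map 𝒜 (F := LinearMap.mul' ℝ A ∘ₗ S.lTensor A)
      (G := LinearMap.mul' ℝ A ∘ₗ TensorProduct.map LinearMap.id (g n).ofConv) ?_ (hcomul n x hx)
    intro i j hij y hy z hz
    simp [hS j z hz, hg j n z hz (by omega)]

/-- Structure maps satisfying the bialgebra axioms together with a connected grading form a Hopf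
algebra. -/
theorem IsConnectedGrading.isHopfAlgebra [AddCommGroup A] [Module ℝ A]
    {𝒜 : ℕ → Submodule ℝ A} {mul : A →ₗ[ℝ] A →ₗ[ℝ] A} {unit : ℝ →ₗ[ℝ] A}
    {comul : A →ₗ[ℝ] A ⊗[ℝ] A} {counit : A →ₗ[ℝ] ℝ}
    (hgr : IsConnectedGrading 𝒜 mul unit comul counit)
    (mul_assoc : ∀ x y z, mul (mul x y) z = mul x (mul y z))
    (one_mul : ∀ x, mul (unit 1) x = x) (mul_one : ∀ x, mul x (unit 1) = x)
    (coassoc : TensorProduct.assoc ℝ A A A ∘ₗ comul.rTensor A ∘ₗ comul =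
      comul.lTensor A ∘ₗ comul)
    (rTensor_counit : counit.rTensor A ∘ₗ comul = TensorProduct.mk ℝ ℝ A 1)
    (lTensor_counit : counit.lTensor A ∘ₗ comul = (TensorProduct.mk ℝ A ℝ).flip 1)
    (counit_one : counit (unit 1) = 1) (counit_mul : ∀ x y, counit (mul x y) = counit x * counit y)
    (comul_one : comul (unit 1) = unit 1 ⊗ₜ unit 1)
    (comul_mul : ∀ x y, comul (mul x y) = TensorProduct.map₂ mul mul (comul x) (comul y)) :
    IsHopfAlgebra mul unit comul counit := by
  let _ : Ring A :=
    { ‹AddCommGroup A› with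
      mul := fun x y => mul x y
      one := unit 1
      mul_assoc := mul_assoc
      one_mul := one_mul
      mul_one := mul_one
      left_distrib := fun x y z => map_add (mul x) y z
      right_distrib := fun x y z => LinearMap.map_add₂ mul x y z
      zero_mul := fun x => LinearMap.map_zero₂ mul x
      mul_zero := fun x => map_zero (mul x) }
  let _ : Algebra ℝ A := Algebra.ofModule (fun r x y => LinearMap.map_smul₂ mul r x y)
    (fun r x y => map_smul (mul x) r y)
  let _ : Coalgebra ℝ A :=
    { comul := comul
      counit := counit
      coassoc := coassoc
      rTensor_counit_comp_comul := rTensor_counit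
      lTensor_counit_comp_comul := lTensor_counit }
  have hmul : ∀ s t : A ⊗[ℝ] A, TensorProduct.map₂ mul mul s t = s * t := fun s t => by
    induction s using TensorProduct.induction_on with
    | zero => rw [map_zero, LinearMap.zero_apply, zero_mul]
    | add s s' hs hs' => rw [map_add, LinearMap.add_apply, hs, hs', add_mul]
    | tmul a b =>
      induction t using TensorProduct.induction_on with
      | zero => rw [map_zero, mul_zero]
      | add t t' ht ht' => rw [map_add, ht, ht', mul_add]
      | tmul c d => exact (Algebra.TensorProduct.tmul_mul_tmul a c b d).symm
  let _ : Bialgebra ℝ A := Bialgebra.mk' ℝ A counit_one (fun {a b} => counit_mul a b) comul_one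
    (fun {a b} => (comul_mul a b).trans (hmul _ _))
  have hunit : ∀ r : ℝ, unit r = algebraMap ℝ A r := fun r => by
    rw [Algebra.algebraMap_eq_smul_one]
    change unit r = r • unit 1
    rw [← map_smul, smul_eq_mul, _root_.mul_one]
  obtain ⟨S, hS₁, hS₂⟩ := exists_antipode (A := A) 𝒜 hgr.isInternal hgr.comul_mem (by
    rw [← hgr.range_unit]
    rintro _ ⟨r, rfl⟩
    exact ⟨r, (hunit r).symm⟩)
  let _ : HopfAlgebra ℝ A :=
    { antipode := S
      mul_antipode_rTensor_comul := hS₁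
      mul_antipode_lTensor_comul := hS₂ }
  refine ⟨A, inferInstance, inferInstance, LinearEquiv.refl ℝ A, fun _ _ => rfl, hunit,
    fun x => ?_, fun _ => rfl⟩
  change TensorProduct.map LinearMap.id LinearMap.id (comul x) = comul x
  rw [TensorProduct.map_id, LinearMap.id_apply]

end

/-! ### Trees modelled on subsets of an ambient set -/

section

namespace RTree

/-- The map `j` identifies the non-root vertices of `T` with the subset `A` of `X`, ordered by the
relation `r`. -/
structure Models (T : RTree) {X : Type w} (j : T.Vert → X) (r : X → X → Prop) (A : Set X) :
    Prop where
  injective : Function.Injective j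
  range_eq : Set.range j = A
  rel_iff : ∀ v w, r (j v) (j w) ↔ v ≤ w

namespace Models

variable {X : Type w} {T S : RTree} {j : T.Vert → X} {k : S.Vert → X} {r r' : X → X → Prop}
  {A B : Set X}

theorem mem (h : T.Models j r A) (v : T.Vert) : j v ∈ A := h.range_eq ▸ Set.mem_range_self v

theorem exists_eq (h : T.Models j r A) {x : X} (hx : x ∈ A) : ∃ v, j v = x := by
  rwa [← h.range_eq] at hx

theorem congr (h : T.Models j r A) (hr : ∀ x ∈ A, ∀ y ∈ A, (r x y ↔ r' x y)) :
    T.Models j r' A :=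
  ⟨h.injective, h.range_eq, fun v w => (hr _ (h.mem v) _ (h.mem w)).symm.trans (h.rel_iff v w)⟩

/-- Passing through `A` matches the non-root vertices in an order-preserving way, and such a
matching extends over the roots. Hence a subset with a relation determines its tree, which makes
`forest` independent of choices. -/
theorem exists_iso (h : T.Models j r A) (h' : S.Models k r A) :
    ∃ φ : T.carrier ≃o S.carrier, ∀ v, k (vertIso φ v) = j v := by
  choose f hf using fun v => h'.exists_eq (h.mem v)
  choose g hg using fun v => h.exists_eq (h'.mem v)
  let π : T.Vert ≃o S.Vert :=
    { toFun := f
      invFun := g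
      left_inv := fun v => h.injective (by rw [hg, hf])
      right_inv := fun v => h'.injective (by rw [hf, hg])
      map_rel_iff' := fun {v w} => by
        rw [← h.rel_iff, ← hf v, ← hf w]
        exact (h'.rel_iff _ _).symm }
  obtain ⟨φ, hφ⟩ := exists_vertIso_eq π
  exact ⟨φ, fun v => by rw [hφ]; exact hf v⟩

/-- Whether `U` contains the root is irrelevant, since `RTree.restrict` always keeps it; accordingly
`hU` only concerns the other vertices. -/
theorem restrict (h : T.Models j r A) (hB : B ⊆ A) (U : Set T.carrier)
    (hU : ∀ v : T.Vert, v.1 ∈ U ↔ j v ∈ B) :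
    (T.restrict U).Models (fun v => j (T.restrictVert U (.inl v))) r B := by
  refine ⟨fun v w hvw => ?_, ?_, fun v w => ?_⟩
  · exact Sum.inl_injective ((T.restrictVert U).injective (h.injective hvw))
  · ext x
    constructor
    · rintro ⟨v, rfl⟩
      refine (hU _).1 (v.1.2.resolve_left fun h' => v.2 (Subtype.ext h'))
    · intro hx
      obtain ⟨v, rfl⟩ := h.exists_eq (hB hx)
      exact ⟨⟨⟨v.1, Or.inr ((hU v).2 hx)⟩, fun h' => v.2 (congrArg Subtype.val h')⟩, rfl⟩
  · exact h.rel_iff _ _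

theorem restrict_compl (h : T.Models j r A) (U : Set T.carrier)
    (hU : ∀ v : T.Vert, v.1 ∈ U ↔ j v ∈ B) :
    (T.restrict Uᶜ).Models (fun v => j (T.restrictVert U (.inr v))) r (A \ B) := by
  refine (h.restrict (B := A \ B) Set.sdiff_subset Uᶜ fun v => ?_).congr fun _ _ _ _ => Iff.rfl
  rw [Set.mem_compl_iff, hU]
  exact ⟨fun h' => ⟨h.mem v, h'⟩, fun h' => h'.2⟩

theorem natCard (h : T.Models j r A) : Nat.card T.Vert = A.ncard := by
  rw [← h.range_eq, ← Set.image_univ, Set.ncard_image_of_injective _ h.injective, Set.ncard_univ]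

end Models

end RTree

/-- Three labelled trees can be realized on disjoint subsets of one finite set. -/
theorem RTree.exists_models₃ {Y : Type*} (T S R : RTree) (l : T.Vert → Y) (m : S.Vert → Y)
    (n : R.Vert → Y) : ∃ (X : Type) (_ : Finite X) (r : X → X → Prop) (L : X → Y) (A B C : Set X)
      (j : T.Vert → X) (k : S.Vert → X) (i : R.Vert → X),
      T.Models j r A ∧ S.Models k r B ∧ R.Models i r C ∧ Disjoint A B ∧ Disjoint A C ∧
        Disjoint B C ∧ (l = fun v => L (j v)) ∧ (m = fun v => L (k v)) ∧ n = fun v => L (i v) := by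
  refine ⟨T.Vert ⊕ (S.Vert ⊕ R.Vert), inferInstance,
    Sum.LiftRel (· ≤ ·) (Sum.LiftRel (· ≤ ·) (· ≤ ·)), Sum.elim l (Sum.elim m n), _, _, _,
    Sum.inl, fun v => Sum.inr (Sum.inl v), fun v => Sum.inr (Sum.inr v),
    ⟨Sum.inl_injective, rfl, fun _ _ => Sum.liftRel_inl_inl⟩,
    ⟨Sum.inr_injective.comp Sum.inl_injective, rfl,
      fun _ _ => Sum.liftRel_inr_inr.trans Sum.liftRel_inl_inl⟩,
    ⟨Sum.inr_injective.comp Sum.inr_injective, rfl,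
      fun _ _ => Sum.liftRel_inr_inr.trans Sum.liftRel_inr_inr⟩, ?_, ?_, ?_, rfl, rfl, rfl⟩ <;>
  · rw [Set.disjoint_left]
    rintro _ ⟨v, rfl⟩ ⟨w, hw⟩
    cases hw

variable {X : Type w} {V : Type u} [AddCommGroup V] [Module ℝ V]

/-- The relation `r` is, on the set `A`, the order of the non-root vertices of a rooted tree. -/
def IsForestOn (r : X → X → Prop) (A : Set X) : Prop :=
  ∃ (T : RTree) (j : T.Vert → X), T.Models j r A

namespace IsForestOn

variable {r r' : X → X → Prop} {A B : Set X}

theorem congr (h : IsForestOn r A) (hr : ∀ x ∈ A, ∀ y ∈ A, (r x y ↔ r' x y)) :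
    IsForestOn r' A :=
  let ⟨T, j, hj⟩ := h
  ⟨T, j, hj.congr hr⟩

theorem mono (h : IsForestOn r A) (hB : B ⊆ A) : IsForestOn r B := by
  obtain ⟨T, j, hj⟩ := h
  refine ⟨_, _, hj.restrict hB {x | ∃ v : T.Vert, v.1 = x ∧ j v ∈ B} fun v => ?_⟩
  constructor
  · rintro ⟨w, hw, hB⟩
    rwa [← Subtype.ext hw]
  · exact fun hv => ⟨v, rfl, hv⟩

theorem refl (h : IsForestOn r A) {x : X} (hx : x ∈ A) : r x x := by
  obtain ⟨T, j, hj⟩ := h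
  obtain ⟨v, rfl⟩ := hj.exists_eq hx
  exact (hj.rel_iff v v).2 le_rfl

theorem trans (h : IsForestOn r A) {x y z : X} (hx : x ∈ A) (hy : y ∈ A) (hz : z ∈ A)
    (hxy : r x y) (hyz : r y z) : r x z := by
  obtain ⟨T, j, hj⟩ := h
  obtain ⟨x, rfl⟩ := hj.exists_eq hx
  obtain ⟨y, rfl⟩ := hj.exists_eq hy
  obtain ⟨z, rfl⟩ := hj.exists_eq hz
  rw [hj.rel_iff] at *
  exact hxy.trans hyz

theorem comparable (h : IsForestOn r A) {x y z : X} (hx : x ∈ A) (hy : y ∈ A) (hz : z ∈ A)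
    (hxz : r x z) (hyz : r y z) : r x y ∨ r y x := by
  obtain ⟨T, j, hj⟩ := h
  obtain ⟨x, rfl⟩ := hj.exists_eq hx
  obtain ⟨y, rfl⟩ := hj.exists_eq hy
  obtain ⟨z, rfl⟩ := hj.exists_eq hz
  simp only [hj.rel_iff] at *
  exact T.comparable_of_le hxz hyz

end IsForestOn

namespace RTree.Models

/-- A tree obtained by grafting is modelled on the union of the sets that model its parts. -/
theorem graft {T S : RTree} {j : T.Vert → X} {k : S.Vert → X} {r R : X → X → Prop} {A B : Set X}
    (h : T.Models j r A) (h' : S.Models k r B) (hAB : Disjoint A B) (d : T.RootChild → S.carrier)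
    (hA : ∀ x ∈ A, ∀ y ∈ A, (r x y ↔ R x y)) (hB : ∀ x ∈ B, ∀ y ∈ B, (r x y ↔ R x y))
    (hR : ∀ x ∈ A, ∀ y ∈ B, ¬ R x y)
    (hd : ∀ s v, R (k s) (j v) ↔ ∃ c : T.RootChild, c.1 ≤ v.1 ∧ s.1 ≤ d c) :
    (RTree.graft d).Models (fun v => Sum.elim j k ((graftVert d).symm v)) R (A ∪ B) := by
  refine ⟨?_, ?_, fun v w => ?_⟩
  · refine Function.Injective.comp (g := Sum.elim j k) ?_ (graftVert d).symm.injective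
    refine h.injective.sumElim h'.injective fun v w hvw => ?_
    exact Set.disjoint_left.1 hAB (h.mem v) (hvw ▸ h'.mem w)
  · rw [← h.range_eq, ← h'.range_eq, ← Set.Sum.elim_range]
    exact (graftVert d).symm.surjective.range_comp (Sum.elim j k)
  · obtain ⟨v, rfl⟩ := (graftVert d).surjective v
    obtain ⟨w, rfl⟩ := (graftVert d).surjective w
    simp only [Equiv.symm_apply_apply]
    rcases v with v | v <;> rcases w with w | w <;> simp only [Sum.elim_inl, Sum.elim_inr]
    · exact (hA _ (h.mem v) _ (h.mem w)).symm.trans (h.rel_iff v w)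
    · exact iff_of_false (hR _ (h.mem v) _ (h'.mem w)) id
    · exact hd v w
    · exact (hB _ (h'.mem v) _ (h'.mem w)).symm.trans (h'.rel_iff v w)

end RTree.Models

/-- The disjoint union of two forests is a forest. -/
theorem IsForestOn.union {R : X → X → Prop} {A B : Set X} (hA : IsForestOn R A)
    (hB : IsForestOn R B) (hAB : Disjoint A B) (h₁ : ∀ x ∈ A, ∀ y ∈ B, ¬ R x y)
    (h₂ : ∀ x ∈ A, ∀ y ∈ B, ¬ R y x) : IsForestOn R (A ∪ B) := by
  obtain ⟨T, j, h⟩ := hA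
  obtain ⟨S, k, h'⟩ := hB
  -- Merging the roots, that is, grafting everything onto `⊥`, creates no relation between non-root
  -- vertices of the two parts.
  refine ⟨_, _, h.graft h' hAB (fun _ => ⊥) (fun _ _ _ _ => Iff.rfl) (fun _ _ _ _ => Iff.rfl) h₁
    fun s v => iff_of_false (h₂ _ (h.mem v) _ (h'.mem s)) ?_⟩
  rintro ⟨c, -, hs⟩
  exact s.2 (le_bot_iff.1 hs)

/-! ### Labelled forests as elements of the tree space -/

namespace TreeSpace

open scoped Classical in
/-- The labelled tree whose non-root vertices are the elements of `A`, ordered by `r` and labelled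
by `l`; it is zero if `r` is not the order of a forest on `A`. -/
noncomputable def forest (r : X → X → Prop) (l : X → V) (A : Set X) : TreeSpace V :=
  if h : IsForestOn r A then
    h.choose.cls (PiTensorProduct.tprod ℝ fun v => l (h.choose_spec.choose v))
  else 0

variable {r r' : X → X → Prop} {l l' : X → V} {A B : Set X}

theorem forest_of_not (h : ¬ IsForestOn r A) : forest r l A = 0 := dif_neg h

/-- The tree chosen in `forest` and `T` model the same set with the same relation. The resulting
isomorphism respects the identifications with `A`, hence also the labels read off from `l`. -/
theorem cls_eq_forest {T : RTree} {j : T.Vert → X} (h : T.Models j r A) (l : X → V) :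
    T.cls (PiTensorProduct.tprod ℝ fun v => l (j v)) = forest r l A := by
  have hA : IsForestOn r A := ⟨T, j, h⟩
  rw [forest, dif_pos hA]
  obtain ⟨φ, hφ⟩ := h.exists_iso hA.choose_spec.choose_spec
  rw [← RTree.cls_relabel φ, RTree.relabel_tprod]
  congr 2
  funext v
  rw [← hφ]
  exact congrArg (fun w => l (hA.choose_spec.choose w)) ((RTree.vertIso φ).apply_symm_apply v)

theorem forest_congr (hr : ∀ x ∈ A, ∀ y ∈ A, (r x y ↔ r' x y)) :
    forest r l A = forest r' l A := by
  by_cases h : IsForestOn r A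
  · obtain ⟨T, j, hj⟩ := h
    rw [← cls_eq_forest hj, ← cls_eq_forest (hj.congr hr)]
  · rw [forest_of_not h, forest_of_not fun h' => h (h'.congr fun x hx y hy => (hr x hx y hy).symm)]

theorem forest_empty (r : X → X → Prop) (l : X → V) : forest r l ∅ = one V := by
  have hE : IsEmpty RTree.single.Vert := ⟨fun v => v.2 rfl⟩
  have h : RTree.single.Models (fun v => hE.elim v) r (∅ : Set X) :=
    ⟨fun v => hE.elim v, Set.range_eq_empty _, fun v => hE.elim v⟩
  rw [← cls_eq_forest h, one]
  congr 2
  exact funext fun v => hE.elim v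

theorem isForestOn_empty (r : X → X → Prop) : IsForestOn r (∅ : Set X) := by
  have hE : IsEmpty RTree.single.Vert := ⟨fun v => v.2 rfl⟩
  exact ⟨RTree.single, fun v => hE.elim v, fun v => hE.elim v, Set.range_eq_empty _,
    fun v => hE.elim v⟩

theorem epsilon_cls (T : RTree) (l : T.Vert → V) [Decidable (IsEmpty T.Vert)] :
    epsilon V (T.cls (PiTensorProduct.tprod ℝ l)) = if IsEmpty T.Vert then 1 else 0 := by
  rw [epsilon, extend_cls]
  by_cases h : IsEmpty T.Vert <;> simp [h]

theorem epsilon_one : epsilon V (one V) = 1 := by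
  classical
  have hE : IsEmpty RTree.single.Vert := ⟨fun v => v.2 rfl⟩
  rw [one, epsilon_cls, if_pos hE]

theorem epsilon_forest (hA : A.Nonempty) : epsilon V (forest r l A) = 0 := by
  classical
  by_cases h : IsForestOn r A
  · obtain ⟨T, j, hj⟩ := h
    rw [← cls_eq_forest hj, epsilon_cls, if_neg]
    obtain ⟨x, hx⟩ := hA
    obtain ⟨v, rfl⟩ := hj.exists_eq hx
    exact not_isEmpty_iff.2 ⟨v⟩
  · rw [forest_of_not h, map_zero]

end TreeSpace

end

/-! ### Extensions, cuts and grafting maps -/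

section

variable {X : Type w} {V : Type u} [AddCommGroup V] [Module ℝ V]

/-- `R` extends to the union of `A` and `B` the relation that `r` defines on `A` and on `B`; the
elements of `A` and those of `B` are related as allowed by `p`. -/
structure IsExtension (p : Prop → Prop → Prop) (r : X → X → Prop) (A B : Set X)
    (R : X → X → Prop) : Prop where
  iff_of_not : ∀ x y, ¬ (x ∈ A ∧ y ∈ B) → ¬ (x ∈ B ∧ y ∈ A) → (R x y ↔ r x y)
  sep : ∀ x ∈ A, ∀ y ∈ B, p (R x y) (R y x)

/-- The set of all extensions of a relation. -/
noncomputable def extensions [Finite X] (p : Prop → Prop → Prop) (r : X → X → Prop)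
    (A B : Set X) : Finset (X → X → Prop) :=
  (Set.toFinite {R | IsExtension p r A B R}).toFinset

@[simp] theorem mem_extensions [Finite X] {p : Prop → Prop → Prop} {r : X → X → Prop}
    {A B : Set X} {R : X → X → Prop} : R ∈ extensions p r A B ↔ IsExtension p r A B R :=
  Set.Finite.mem_toFinset _

/-- The subset `U` of `A` is related to its complement as allowed by `n`. -/
structure IsCut (n : Prop → Prop → Prop) (r : X → X → Prop) (A U : Set X) : Prop where
  subset : U ⊆ A
  sep : ∀ x ∈ U, ∀ y ∈ A \ U, n (r x y) (r y x)

/-- The set of all cuts of a subset. -/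
noncomputable def cuts [Finite X] (n : Prop → Prop → Prop) (r : X → X → Prop) (A : Set X) :
    Finset (Set X) :=
  (Set.toFinite {U | IsCut n r A U}).toFinset

@[simp] theorem mem_cuts [Finite X] {n : Prop → Prop → Prop} {r : X → X → Prop}
    {A U : Set X} : U ∈ cuts n r A ↔ IsCut n r A U :=
  Set.Finite.mem_toFinset _

/-- No element of the first set is below an element of the second one. -/
def NotBelow (a _b : Prop) : Prop := ¬ a

/-- The elements of the two sets are incomparable. -/
def Incomparable (a b : Prop) : Prop := ¬ a ∧ ¬ b

namespace IsExtension

variable {p : Prop → Prop → Prop} {r R : X → X → Prop} {A B : Set X}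

theorem left (h : IsExtension p r A B R) (hAB : Disjoint A B) :
    ∀ x ∈ A, ∀ y ∈ A, (R x y ↔ r x y) := fun _ hx _ hy =>
  h.iff_of_not _ _ (fun h' => Set.disjoint_left.1 hAB hy h'.2)
    fun h' => Set.disjoint_left.1 hAB hx h'.1

theorem right (h : IsExtension p r A B R) (hAB : Disjoint A B) :
    ∀ x ∈ B, ∀ y ∈ B, (R x y ↔ r x y) := fun _ hx _ hy =>
  h.iff_of_not _ _ (fun h' => Set.disjoint_left.1 hAB h'.1 hx)
    fun h' => Set.disjoint_left.1 hAB h'.2 hy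

theorem isForestOn (h : IsExtension p r A B R) (hAB : Disjoint A B)
    (hR : IsForestOn R (A ∪ B)) : IsForestOn r A ∧ IsForestOn r B :=
  ⟨(hR.mono Set.subset_union_left).congr (h.left hAB),
    (hR.mono Set.subset_union_right).congr (h.right hAB)⟩

end IsExtension

section graftRel

variable {T S : RTree} {j : T.Vert → X} {k : S.Vert → X} {r R : X → X → Prop} {A B : Set X}

/-- The relation that describes grafting in the ambient set `X`. -/
def graftRel (j : T.Vert → X) (k : S.Vert → X) (r : X → X → Prop) (A B : Set X)
    (d : T.RootChild → S.carrier) (x y : X) : Prop :=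
  (∃ s v, k s = x ∧ j v = y ∧ ∃ c : T.RootChild, c.1 ≤ v.1 ∧ s.1 ≤ d c) ∨
    (¬ (x ∈ A ∧ y ∈ B) ∧ ¬ (x ∈ B ∧ y ∈ A) ∧ r x y)

theorem graftRel_iff (h : T.Models j r A) (h' : S.Models k r B) (d : T.RootChild → S.carrier)
    (s : S.Vert) (v : T.Vert) : graftRel j k r A B d (k s) (j v) ↔
      ∃ c : T.RootChild, c.1 ≤ v.1 ∧ s.1 ≤ d c := by
  constructor
  · rintro (⟨s', v', hs, hv, hc⟩ | ⟨-, h₂, -⟩)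
    · rwa [← h'.injective hs, ← h.injective hv]
    · exact absurd ⟨h'.mem s, h.mem v⟩ h₂
  · exact fun hc => Or.inl ⟨s, v, rfl, rfl, hc⟩

theorem not_graftRel (h : T.Models j r A) (hAB : Disjoint A B)
    (d : T.RootChild → S.carrier) {x y : X} (hx : x ∈ A) (hy : y ∈ B) :
    ¬ graftRel j k r A B d x y := by
  rintro (⟨s, v, hs, rfl, hc⟩ | ⟨h₁, -, -⟩)
  · exact Set.disjoint_left.1 hAB (h.mem v) hy
  · exact h₁ ⟨hx, hy⟩

theorem isExtension_graftRel (h : T.Models j r A) (h' : S.Models k r B) (hAB : Disjoint A B)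
    (d : T.RootChild → S.carrier) : IsExtension NotBelow r A B (graftRel j k r A B d) := by
  refine ⟨fun x y h₁ h₂ => ⟨?_, fun hr => Or.inr ⟨h₁, h₂, hr⟩⟩,
    fun x hx y hy => not_graftRel h hAB d hx hy⟩
  rintro (⟨s, v, rfl, rfl, hc⟩ | ⟨-, -, hr⟩)
  · exact absurd ⟨h'.mem s, h.mem v⟩ h₂
  · exact hr

theorem models_graftRel (h : T.Models j r A) (h' : S.Models k r B) (hAB : Disjoint A B)
    (d : T.RootChild → S.carrier) :
    (RTree.graft d).Models (fun v => Sum.elim j k ((RTree.graftVert d).symm v))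
      (graftRel j k r A B d) (A ∪ B) :=
  have hd := isExtension_graftRel h h' hAB d
  h.graft h' hAB d (fun x hx y hy => (hd.left hAB x hx y hy).symm)
    (fun x hx y hy => (hd.right hAB x hx y hy).symm) (fun _ hx _ hy => not_graftRel h hAB d hx hy)
    (graftRel_iff h h' d)

theorem cls_graft (h : T.Models j r A) (h' : S.Models k r B) (hAB : Disjoint A B)
    (d : T.RootChild → S.carrier) (l : X → V) :
    (RTree.graft d).cls (RTree.graftTens d (PiTensorProduct.tprod ℝ fun v => l (j v))
      (PiTensorProduct.tprod ℝ fun v => l (k v))) =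
        TreeSpace.forest (graftRel j k r A B d) l (A ∪ B) := by
  rw [RTree.graftTens_tprod, ← TreeSpace.cls_eq_forest (models_graftRel h h' hAB d)]
  congr 2
  funext v
  rcases (RTree.graftVert d).symm v with v | v <;> rfl

/-- A child of the root, as a vertex. -/
def RTree.RootChild.toVert (c : T.RootChild) : T.Vert := ⟨c.1, c.2.1.ne'⟩

/-- The value `d c` is recovered as the top of the set of vertices of `S` placed below the child
`c`. The root of `S` is not an element of `X`, so the value `⊥` shows up as the absence of such
vertices. -/
theorem graftRel_injective (h : T.Models j r A) (h' : S.Models k r B) :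
    Function.Injective (graftRel j k r A B : (T.RootChild → S.carrier) → X → X → Prop) := by
  have key : ∀ (d : T.RootChild → S.carrier) (c : T.RootChild) (s : S.Vert),
      s.1 ≤ d c ↔ graftRel j k r A B d (k s) (j (RTree.RootChild.toVert c)) := by
    intro d c s
    rw [graftRel_iff h h']
    refine ⟨fun hs => ⟨c, le_rfl, hs⟩, ?_⟩
    rintro ⟨c', hc', hs⟩
    rwa [← T.rootChild_unique hc' (le_refl c.1)]
  have hle : ∀ (d e : T.RootChild → S.carrier) (c : T.RootChild),
      graftRel j k r A B d = graftRel j k r A B e → d c ≤ e c := by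
    intro d e c hde
    by_cases hb : d c = ⊥
    · rw [hb]; exact bot_le
    · have := (key d c ⟨d c, hb⟩).1 le_rfl
      rw [hde] at this
      exact (key e c ⟨d c, hb⟩).2 this
  exact fun d e hde => funext fun c => le_antisymm (hle d e c hde) (hle e d c hde.symm)

/-- In a forest the elements of `B` below a child `c` form a chain. Its largest element, or the root
if the chain is empty, is the vertex to which `c` is attached, and the remaining relations follow by
transitivity. -/
theorem exists_graftRel_eq (h : T.Models j r A) (h' : S.Models k r B) (hAB : Disjoint A B)
    (hR : IsExtension NotBelow r A B R) (hF : IsForestOn R (A ∪ B)) :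
    ∃ d : T.RootChild → S.carrier, graftRel j k r A B d = R := by
  have hA : ∀ v, j v ∈ A ∪ B := fun v => Or.inl (h.mem v)
  have hB : ∀ s, k s ∈ A ∪ B := fun s => Or.inr (h'.mem s)
  have hrB : ∀ s s', R (k s) (k s') ↔ s ≤ s' := fun s s' =>
    (hR.right hAB _ (h'.mem s) _ (h'.mem s')).trans (h'.rel_iff s s')
  have hrA : ∀ s s', R (j s) (j s') ↔ s ≤ s' := fun s s' =>
    (hR.left hAB _ (h.mem s) _ (h.mem s')).trans (h.rel_iff s s')
  have hex : ∀ c : T.RootChild, ∃ m : S.carrier, ∀ s : S.Vert,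
      s.1 ≤ m ↔ R (k s) (j (RTree.RootChild.toVert c)) := by
    intro c
    -- The condition is vacuous at `⊥`, so `D` is nonempty even if no element of `B` lies below `c`.
    let D : Set S.carrier :=
      {x | ∀ hx : x ≠ ⊥, R (k ⟨x, hx⟩) (j (RTree.RootChild.toVert c))}
    obtain ⟨m, hm⟩ := (Set.toFinite D).exists_maximal ⟨⊥, fun hx => absurd rfl hx⟩
    refine ⟨m, fun s => ⟨fun hs => ?_, fun hs => ?_⟩⟩
    · have hmb : m ≠ ⊥ := fun hmb => s.2 (le_bot_iff.1 (hmb ▸ hs))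
      exact hF.trans (hB _) (hB _) (hA _) ((hrB s ⟨m, hmb⟩).2 hs) (hm.1 hmb)
    · have hsD : s.1 ∈ D := fun _ => hs
      by_cases hmb : m = ⊥
      · exact hm.2 hsD (hmb.le.trans bot_le)
      · rcases hF.comparable (hB _) (hB _) (hA _) hs (hm.1 hmb) with h₁ | h₁
        · exact (hrB _ _).1 h₁
        · exact hm.2 hsD ((hrB ⟨m, hmb⟩ s).1 h₁)
  choose d hd using hex
  refine ⟨d, funext fun x => funext fun y => propext ?_⟩
  have hext := isExtension_graftRel h h' hAB d
  by_cases h₁ : x ∈ A ∧ y ∈ B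
  · exact iff_of_false (hext.sep x h₁.1 y h₁.2) (hR.sep x h₁.1 y h₁.2)
  by_cases h₂ : x ∈ B ∧ y ∈ A
  · obtain ⟨s, rfl⟩ := h'.exists_eq h₂.1
    obtain ⟨v, rfl⟩ := h.exists_eq h₂.2
    rw [graftRel_iff h h']
    constructor
    · rintro ⟨c, hc, hs⟩
      exact hF.trans (hB _) (hA _) (hA _) ((hd c s).1 hs)
        ((hrA (RTree.RootChild.toVert c) v).2 hc)
    · intro hs
      obtain ⟨c, hc⟩ := T.exists_rootChild_le v
      refine ⟨c, hc, (hd c s).2 ?_⟩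
      -- Both `s` and the child `c` lie below `v`, so they are comparable; `c` below `s` would put
      -- an element of `A` below one of `B`.
      refine (hF.comparable (hB _) (hA _) (hA _) hs
        ((hrA (RTree.RootChild.toVert c) v).2 hc)).resolve_right ?_
      exact hR.sep _ (h.mem _) _ (h'.mem _)
  · rw [hext.iff_of_not x y h₁ h₂, hR.iff_of_not x y h₁ h₂]

end graftRel

/-! ### The four operations on forests -/

namespace TreeSpace

variable {r : X → X → Prop} {l : X → V} {A B : Set X}

theorem forest_extension_eq_zero {p : Prop → Prop → Prop} {R : X → X → Prop}
    (hAB : Disjoint A B) (hR : IsExtension p r A B R)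
    (h : ¬ (IsForestOn r A ∧ IsForestOn r B)) : forest R l (A ∪ B) = 0 :=
  forest_of_not fun hF => h (hR.isForestOn hAB hF)

/-- Grafting maps correspond bijectively to those extensions that are forests, and the other
extensions contribute zero. If `A` or `B` is not a forest, both sides vanish, so no hypothesis on
`r` is needed and the formula can be iterated. -/
theorem star_forest [Finite X] (r : X → X → Prop) (l : X → V) (hAB : Disjoint A B) :
    star V (forest r l A) (forest r l B) =
      ∑ R ∈ extensions NotBelow r A B, forest R l (A ∪ B) := by
  by_cases h : IsForestOn r A ∧ IsForestOn r B
  · obtain ⟨⟨T, j, hT⟩, ⟨S, k, hS⟩⟩ := h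
    rw [← cls_eq_forest hT, ← cls_eq_forest hS, star_cls]
    refine Finset.sum_of_injOn (graftRel j k r A B) (graftRel_injective hT hS).injOn
      (fun d _ => mem_extensions.2 (isExtension_graftRel hT hS hAB d)) (fun R hR hn => ?_)
      fun d _ => cls_graft hT hS hAB d l
    refine forest_of_not fun hF => hn ?_
    obtain ⟨d, hd⟩ := exists_graftRel_eq hT hS hAB (mem_extensions.1 hR) hF
    exact ⟨d, Finset.mem_coe.2 (Finset.mem_univ d), hd⟩
  · rw [Finset.sum_eq_zero fun R hR => forest_extension_eq_zero hAB (mem_extensions.1 hR) h]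
    by_cases hA : IsForestOn r A
    · rw [forest_of_not fun hB => h ⟨hA, hB⟩, map_zero]
    · rw [forest_of_not hA, map_zero, LinearMap.zero_apply]

/-- Incomparability leaves exactly one extension, the one realized by grafting everything onto the
root. -/
theorem circ_forest [Finite X] (r : X → X → Prop) (l : X → V) (hAB : Disjoint A B) :
    circ V (forest r l A) (forest r l B) =
      ∑ R ∈ extensions Incomparable r A B, forest R l (A ∪ B) := by
  by_cases h : IsForestOn r A ∧ IsForestOn r B
  · obtain ⟨⟨T, j, hT⟩, ⟨S, k, hS⟩⟩ := h
    rw [← cls_eq_forest hT, ← cls_eq_forest hS, circ_cls, cls_graft hT hS hAB]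
    have h₀ := isExtension_graftRel hT hS hAB (fun _ : T.RootChild => (⊥ : S.carrier))
    have h₁ : ∀ x ∈ A, ∀ y ∈ B,
        ¬ graftRel j k r A B (fun _ : T.RootChild => (⊥ : S.carrier)) y x := by
      intro x hx y hy
      obtain ⟨v, rfl⟩ := hT.exists_eq hx
      obtain ⟨s, rfl⟩ := hS.exists_eq hy
      rw [graftRel_iff hT hS]
      rintro ⟨c, -, hs⟩
      exact s.2 (le_bot_iff.1 hs)
    have h₂ : IsExtension Incomparable r A B (graftRel j k r A B fun _ => ⊥) :=
      ⟨h₀.iff_of_not, fun x hx y hy => ⟨h₀.sep x hx y hy, h₁ x hx y hy⟩⟩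
    refine (Finset.sum_eq_single_of_mem (f := fun R => forest R l (A ∪ B)) _
      (mem_extensions.2 h₂) fun R hR hne => ?_).symm
    rw [mem_extensions] at hR
    refine absurd (funext fun x => funext fun y => propext ?_) hne
    by_cases hxy : x ∈ A ∧ y ∈ B
    · exact iff_of_false (hR.sep x hxy.1 y hxy.2).1 (h₀.sep x hxy.1 y hxy.2)
    by_cases hyx : x ∈ B ∧ y ∈ A
    · exact iff_of_false (hR.sep y hyx.2 x hyx.1).2 (h₁ y hyx.2 x hyx.1)
    · rw [hR.iff_of_not x y hxy hyx, h₀.iff_of_not x y hxy hyx]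
  · rw [Finset.sum_eq_zero fun R hR => forest_extension_eq_zero hAB (mem_extensions.1 hR) h]
    by_cases hA : IsForestOn r A
    · rw [forest_of_not fun hB => h ⟨hA, hB⟩, map_zero]
    · rw [forest_of_not hA, map_zero, LinearMap.zero_apply]

theorem splitCls_eq_forest {T : RTree} {j : T.Vert → X} (h : T.Models j r A) (l : X → V)
    (U : Set T.carrier) :
    T.splitCls U (PiTensorProduct.tprod ℝ fun v => l (j v)) =
      forest r l (j '' {v | v.1 ∈ U}) ⊗ₜ forest r l (A \ j '' {v | v.1 ∈ U}) := by
  have hU : ∀ v : T.Vert, v.1 ∈ U ↔ j v ∈ j '' {v | v.1 ∈ U} := fun v =>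
    (h.injective.mem_set_image (s := {v : T.Vert | v.1 ∈ U})).symm
  rw [RTree.splitCls, LinearMap.comp_apply, RTree.splitTens_tprod, TensorProduct.map_tmul,
    ← cls_eq_forest (h.restrict ?_ U hU), ← cls_eq_forest (h.restrict_compl U hU)]
  rintro _ ⟨v, -, rfl⟩
  exact h.mem v

/-- An antichain generates an up-set, and a finite up-set is recovered from its antichain of minimal
elements. The forest hypothesis matters: two incomparable elements below a third one are not a
forest, yet cutting off the third leaves two forests. -/
theorem deltaCK_forest [Finite X] {r : X → X → Prop} (l : X → V) (hA : IsForestOn r A) :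
    deltaCK V (forest r l A) = ∑ U ∈ cuts NotBelow r A, forest r l U ⊗ₜ forest r l (A \ U) := by
  obtain ⟨T, j, h⟩ := hA
  rw [← cls_eq_forest h, deltaCK_cls]
  have hmem : ∀ (C : Set T.carrier) (v : T.Vert),
      j v ∈ j '' {v | v.1 ∈ T.above C} ↔ v.1 ∈ T.above C := fun C v =>
    h.injective.mem_set_image (s := {v : T.Vert | v.1 ∈ T.above C})
  refine Finset.sum_bij' (fun C _ => j '' {v | v.1 ∈ T.above C.1})
    (fun U _ => ⟨{x | Minimal (fun x => ∃ v : T.Vert, v.1 = x ∧ j v ∈ U) x}, ?_, ?_⟩)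
    (fun C _ => ?_) (fun _ _ => Finset.mem_univ _) (fun C _ => ?_) (fun U hU => ?_)
    fun C _ => splitCls_eq_forest h l _
  · rintro ⟨⟨v, hv, -⟩, -⟩
    exact v.2 hv
  · exact setOfPred_minimal_antichain _
  · refine mem_cuts.2 ⟨?_, ?_⟩
    · rintro _ ⟨v, -, rfl⟩
      exact h.mem v
    · rintro _ ⟨v, ⟨w, hw, hwv⟩, rfl⟩ y ⟨hy, hyU⟩ hvy
      obtain ⟨y, rfl⟩ := h.exists_eq hy
      exact hyU ((hmem _ _).2 ⟨w, hw, hwv.trans ((h.rel_iff v y).1 hvy)⟩)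
  · refine Subtype.ext (Set.ext fun x => ?_)
    simp only [hmem, Set.mem_ofPred_eq]
    have hne : ∀ y ∈ C.1, y ≠ ⊥ := fun y hy hb => C.2.1 (hb ▸ hy)
    constructor
    · rintro ⟨⟨v, rfl, w, hw, hwv⟩, hmin⟩
      have := hmin ⟨⟨w, hne w hw⟩, rfl, w, hw, le_rfl⟩ hwv
      exact le_antisymm hwv this ▸ hw
    · intro hx
      refine ⟨⟨⟨x, hne x hx⟩, rfl, x, hx, le_rfl⟩, ?_⟩
      rintro _ ⟨v, rfl, w, hw, hwv⟩ hvx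
      have := C.2.2.eq hw hx (hwv.trans hvx)
      exact this ▸ hwv
  · rw [mem_cuts] at hU
    ext x
    constructor
    · rintro ⟨v, ⟨w, ⟨⟨⟨w, rfl, hw⟩, -⟩, hwv⟩⟩, rfl⟩
      by_contra hv
      exact hU.sep _ hw _ ⟨h.mem v, hv⟩ ((h.rel_iff w v).2 hwv)
    · intro hx
      obtain ⟨v, rfl⟩ := h.exists_eq (hU.subset hx)
      rw [hmem]
      obtain ⟨m, hm, hmin⟩ := (Set.toFinite {x | ∃ v : T.Vert, v.1 = x ∧ j v ∈ U}).exists_le_minimal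
        (show v.1 ∈ _ from ⟨v, rfl, hx⟩)
      exact ⟨m, hmin, hm⟩

/-- A subset unrelated to its complement contains a vertex exactly when it contains the child of the
root below that vertex, so it is a union of branches. -/
theorem deltaGL_forest [Finite X] {r : X → X → Prop} (l : X → V) (hA : IsForestOn r A) :
    deltaGL V (forest r l A) =
      ∑ U ∈ cuts Incomparable r A, forest r l U ⊗ₜ forest r l (A \ U) := by
  obtain ⟨T, j, h⟩ := hA
  rw [← cls_eq_forest h, deltaGL_cls]
  have hmem : ∀ (I : Set T.RootChild) (v : T.Vert),
      j v ∈ j '' {v | v.1 ∈ T.branches I} ↔ v.1 ∈ T.branches I := fun I v =>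
    h.injective.mem_set_image (s := {v : T.Vert | v.1 ∈ T.branches I})
  refine Finset.sum_bij' (fun I _ => j '' {v | v.1 ∈ T.branches I})
    (fun U _ => {c | j (RTree.RootChild.toVert c) ∈ U})
    (fun I _ => ?_) (fun _ _ => Finset.mem_univ _) (fun I _ => ?_) (fun U hU => ?_)
    fun C _ => splitCls_eq_forest h l _
  · refine mem_cuts.2 ⟨?_, ?_⟩
    · rintro _ ⟨v, -, rfl⟩
      exact h.mem v
    · rintro _ ⟨v, ⟨_, ⟨c, hc, rfl⟩, hcv⟩, rfl⟩ y ⟨hy, hyU⟩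
      obtain ⟨y, rfl⟩ := h.exists_eq hy
      rw [hmem] at hyU
      refine ⟨fun hvy => hyU ⟨c.1, ⟨c, hc, rfl⟩, hcv.trans ((h.rel_iff v y).1 hvy)⟩, fun hyv => ?_⟩
      obtain ⟨c', hc'⟩ := T.exists_rootChild_le y
      have := T.rootChild_unique (hc'.trans ((h.rel_iff y v).1 hyv)) hcv
      exact hyU ⟨c.1, ⟨c, hc, rfl⟩, this ▸ hc'⟩
  · ext c
    rw [Set.mem_ofPred_eq, hmem]
    constructor
    · rintro ⟨_, ⟨c', hc', rfl⟩, hle⟩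
      rwa [← T.rootChild_unique hle (le_refl c.1)]
    · exact fun hc => ⟨c.1, ⟨c, hc, rfl⟩, le_rfl⟩
  · rw [mem_cuts] at hU
    ext x
    constructor
    · rintro ⟨v, ⟨_, ⟨c, hc, rfl⟩, hcv⟩, rfl⟩
      by_contra hv
      exact (hU.sep _ hc _ ⟨h.mem v, hv⟩).1 ((h.rel_iff (RTree.RootChild.toVert c) v).2 hcv)
    · intro hx
      obtain ⟨v, rfl⟩ := h.exists_eq (hU.subset hx)
      rw [hmem]
      obtain ⟨c, hc⟩ := T.exists_rootChild_le v
      refine ⟨c.1, ⟨c, ?_, rfl⟩, hc⟩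
      by_contra hcU
      exact (hU.sep _ hx _ ⟨h.mem _, hcU⟩).2 ((h.rel_iff (RTree.RootChild.toVert c) v).2 hc)

end TreeSpace

end

/-! ### Testing multilinear identities on forests -/

section

variable {V : Type u} [AddCommGroup V] [Module ℝ V]

namespace TreeSpace

section ext

variable {M : Type*} [AddCommGroup M] [Module ℝ M]

theorem hom_ext_forest {f g : TreeSpace V →ₗ[ℝ] M}
    (h : ∀ (X : Type) [Finite X] (r : X → X → Prop) (l : X → V) (A : Set X), IsForestOn r A →
      f (forest r l A) = g (forest r l A)) : f = g := by
  refine hom_ext fun T l => ?_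
  have hT : T.Models id (fun v w => v ≤ w) Set.univ :=
    ⟨Function.injective_id, Set.range_id, fun _ _ => Iff.rfl⟩
  have := h T.Vert (fun v w => v ≤ w) l Set.univ ⟨T, _, hT⟩
  rwa [← cls_eq_forest hT l] at this

theorem hom_ext_forest₃ {f g : TreeSpace V →ₗ[ℝ] TreeSpace V →ₗ[ℝ] TreeSpace V →ₗ[ℝ] M}
    (h : ∀ (X : Type) [Finite X] (r : X → X → Prop) (l : X → V) (A B C : Set X), IsForestOn r A →
      IsForestOn r B → IsForestOn r C → Disjoint A B → Disjoint A C → Disjoint B C →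
      f (forest r l A) (forest r l B) (forest r l C) =
        g (forest r l A) (forest r l B) (forest r l C)) : f = g := by
  refine hom_ext fun T l => hom_ext fun S m => hom_ext fun R n => ?_
  obtain ⟨X, _, r, L, A, B, C, j, k, i, hT, hS, hR, hAB, hAC, hBC, rfl, rfl, rfl⟩ :=
    RTree.exists_models₃ T S R l m n
  rw [cls_eq_forest hT, cls_eq_forest hS, cls_eq_forest hR]
  exact h X r L A B C ⟨T, j, hT⟩ ⟨S, k, hS⟩ ⟨R, i, hR⟩ hAB hAC hBC

theorem hom_ext_forest₂ {f g : TreeSpace V →ₗ[ℝ] TreeSpace V →ₗ[ℝ] M}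
    (h : ∀ (X : Type) [Finite X] (r : X → X → Prop) (l : X → V) (A B : Set X), IsForestOn r A →
      IsForestOn r B → Disjoint A B →
      f (forest r l A) (forest r l B) = g (forest r l A) (forest r l B)) : f = g := by
  -- A third argument is added as the scalar factor `epsilon`; evaluating it at `one V`, where
  -- `epsilon` is `1`, removes it again.
  have := hom_ext_forest₃ (f := f.compr₂ (LinearMap.smulRightₗ (epsilon V)))
    (g := g.compr₂ (LinearMap.smulRightₗ (epsilon V))) fun X _ r l A B C hA hB _ hAB _ _ => by
      simp only [LinearMap.compr₂_apply, h X r l A B hA hB hAB]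
  refine LinearMap.ext fun x => LinearMap.ext fun y => ?_
  simpa [epsilon_one] using LinearMap.congr_fun (LinearMap.congr_fun₂ this x y) (one V)

end ext

/-- The product `mul` is given on forests by summing over all extensions of type `p`. -/
def IsForestMul (p : Prop → Prop → Prop)
    (mul : TreeSpace V →ₗ[ℝ] TreeSpace V →ₗ[ℝ] TreeSpace V) : Prop :=
  ∀ {X : Type} [Finite X] (r : X → X → Prop) (l : X → V) {A B : Set X}, Disjoint A B →
    mul (forest r l A) (forest r l B) = ∑ R ∈ extensions p r A B, forest R l (A ∪ B)

/-- The coproduct `comul` is given on forests by summing over all cuts of type `n`. -/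
def IsForestComul (n : Prop → Prop → Prop)
    (comul : TreeSpace V →ₗ[ℝ] TreeSpace V ⊗[ℝ] TreeSpace V) : Prop :=
  ∀ {X : Type} [Finite X] {r : X → X → Prop} (l : X → V) {A : Set X}, IsForestOn r A →
    comul (forest r l A) = ∑ U ∈ cuts n r A, forest r l U ⊗ₜ forest r l (A \ U)

end TreeSpace

/-! ### Reindexing for associativity and coassociativity -/

section combinatorics

variable {X : Type w} {p n : Prop → Prop → Prop} {r : X → X → Prop}

/-- Relations on the union of three sets that extend a relation on each of them. -/
structure IsExtension₃ (p : Prop → Prop → Prop) (r : X → X → Prop) (A B C : Set X)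
    (Q : X → X → Prop) : Prop where
  iff_of_not : ∀ x y, ¬ (x ∈ A ∧ y ∈ B) → ¬ (x ∈ B ∧ y ∈ A) → ¬ (x ∈ A ∧ y ∈ C) →
    ¬ (x ∈ C ∧ y ∈ A) → ¬ (x ∈ B ∧ y ∈ C) → ¬ (x ∈ C ∧ y ∈ B) → (Q x y ↔ r x y)
  sep₁ : ∀ x ∈ A, ∀ y ∈ B, p (Q x y) (Q y x)
  sep₂ : ∀ x ∈ A, ∀ y ∈ C, p (Q x y) (Q y x)
  sep₃ : ∀ x ∈ B, ∀ y ∈ C, p (Q x y) (Q y x)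

/-- The relation that is given by `Q` between `A` and `B` and by `r` elsewhere. -/
def patch (Q r : X → X → Prop) (A B : Set X) (x y : X) : Prop :=
  ((x ∈ A ∧ y ∈ B ∨ x ∈ B ∧ y ∈ A) ∧ Q x y) ∨ (¬ (x ∈ A ∧ y ∈ B ∨ x ∈ B ∧ y ∈ A) ∧ r x y)

theorem patch_of {Q r : X → X → Prop} {A B : Set X} {x y : X}
    (h : x ∈ A ∧ y ∈ B ∨ x ∈ B ∧ y ∈ A) : patch Q r A B x y = Q x y := by
  simp [patch, h]

theorem patch_of_not {Q r : X → X → Prop} {A B : Set X} {x y : X}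
    (h : ¬ (x ∈ A ∧ y ∈ B ∨ x ∈ B ∧ y ∈ A)) : patch Q r A B x y = r x y := by
  simp [patch, h]

variable [Finite X]

theorem extensions_empty_left (p : Prop → Prop → Prop) (r : X → X → Prop) (A : Set X) :
    extensions p r ∅ A = {r} := by
  ext R
  rw [mem_extensions, Finset.mem_singleton]
  refine ⟨fun h => funext fun x => funext fun y => propext (h.iff_of_not x y (by simp) (by simp)),
    ?_⟩
  rintro rfl
  exact ⟨fun _ _ _ _ => Iff.rfl, by simp⟩

theorem extensions_empty_right (p : Prop → Prop → Prop) (r : X → X → Prop) (A : Set X) :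
    extensions p r A ∅ = {r} := by
  ext R
  rw [mem_extensions, Finset.mem_singleton]
  refine ⟨fun h => funext fun x => funext fun y => propext (h.iff_of_not x y (by simp) (by simp)),
    ?_⟩
  rintro rfl
  exact ⟨fun _ _ _ _ => Iff.rfl, by simp⟩

variable {A B C : Set X}

/-- The intermediate relation `R` carries no information of its own: it equals `Q` between `A` and
`B`, and `r` elsewhere. -/
theorem sum_extensions_left {M : Type*} [AddCommMonoid M] (hAB : Disjoint A B)
    (hAC : Disjoint A C) (hBC : Disjoint B C) (f : (X → X → Prop) → M) :
    ∑ R ∈ extensions p r A B, ∑ Q ∈ extensions p R (A ∪ B) C, f Q =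
      ∑ Q ∈ (Set.toFinite {Q | IsExtension₃ p r A B C Q}).toFinset, f Q := by
  rw [Finset.sum_sigma']
  rw [Set.disjoint_left] at hAB hAC hBC
  refine Finset.sum_bij' (fun s _ => s.2) (fun Q _ => ⟨patch Q r A B, Q⟩) ?_ ?_ ?_ ?_ ?_
  · rintro ⟨R, Q⟩ h
    simp only [Finset.mem_sigma, mem_extensions, Set.Finite.mem_toFinset, Set.mem_ofPred_eq] at h ⊢
    obtain ⟨⟨h₁, h₂⟩, ⟨h₃, h₄⟩⟩ := h
    constructor <;> grind
  · intro Q h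
    simp only [Finset.mem_sigma, mem_extensions, Set.Finite.mem_toFinset, Set.mem_ofPred_eq] at h ⊢
    obtain ⟨h₁, h₂, h₃, h₄⟩ := h
    refine ⟨⟨?_, ?_⟩, ?_, ?_⟩ <;> grind [patch_of, patch_of_not]
  · rintro ⟨R, Q⟩ h
    simp only [Finset.mem_sigma, mem_extensions] at h
    obtain ⟨⟨h₁, h₂⟩, ⟨h₃, h₄⟩⟩ := h
    have : patch Q r A B = R := by
      funext x y
      by_cases h : x ∈ A ∧ y ∈ B ∨ x ∈ B ∧ y ∈ A
      · rw [patch_of h]; grind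
      · rw [patch_of_not h]; grind
    rw [this]
  · intros; rfl
  · intros; rfl

theorem sum_extensions_right {M : Type*} [AddCommMonoid M] (hAB : Disjoint A B)
    (hAC : Disjoint A C) (hBC : Disjoint B C) (f : (X → X → Prop) → M) :
    ∑ R ∈ extensions p r B C, ∑ Q ∈ extensions p R A (B ∪ C), f Q =
      ∑ Q ∈ (Set.toFinite {Q | IsExtension₃ p r A B C Q}).toFinset, f Q := by
  rw [Finset.sum_sigma']
  rw [Set.disjoint_left] at hAB hAC hBC
  refine Finset.sum_bij' (fun s _ => s.2) (fun Q _ => ⟨patch Q r B C, Q⟩) ?_ ?_ ?_ ?_ ?_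
  · rintro ⟨R, Q⟩ h
    simp only [Finset.mem_sigma, mem_extensions, Set.Finite.mem_toFinset, Set.mem_ofPred_eq] at h ⊢
    obtain ⟨⟨h₁, h₂⟩, ⟨h₃, h₄⟩⟩ := h
    constructor <;> grind
  · intro Q h
    simp only [Finset.mem_sigma, mem_extensions, Set.Finite.mem_toFinset, Set.mem_ofPred_eq] at h ⊢
    obtain ⟨h₁, h₂, h₃, h₄⟩ := h
    refine ⟨⟨?_, ?_⟩, ?_, ?_⟩ <;> grind [patch_of, patch_of_not]
  · rintro ⟨R, Q⟩ h
    simp only [Finset.mem_sigma, mem_extensions] at h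
    obtain ⟨⟨h₁, h₂⟩, ⟨h₃, h₄⟩⟩ := h
    have : patch Q r B C = R := by
      funext x y
      by_cases h : x ∈ B ∧ y ∈ C ∨ x ∈ C ∧ y ∈ B
      · rw [patch_of h]; grind
      · rw [patch_of_not h]; grind
    rw [this]
  · intros; rfl
  · intros; rfl

/-- Both sides enumerate ordered partitions of `A` into three blocks in which every earlier block is
related to every later one as `n` allows. On the left they are `W`, `U \ W`, `A \ U`; on the right
`U`, `W`, `(A \ U) \ W`. -/
theorem sum_cuts_cuts {M : Type*} [AddCommMonoid M] (A : Set X) (f : Set X → Set X → Set X → M) :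
    ∑ U ∈ cuts n r A, ∑ W ∈ cuts n r U, f W (U \ W) (A \ U) =
      ∑ U ∈ cuts n r A, ∑ W ∈ cuts n r (A \ U), f U W ((A \ U) \ W) := by
  rw [Finset.sum_sigma', Finset.sum_sigma']
  refine Finset.sum_bij' (fun s _ => ⟨s.2, s.1 \ s.2⟩) (fun s _ => ⟨s.1 ∪ s.2, s.1⟩) ?_ ?_ ?_ ?_ ?_
  · rintro ⟨U, W⟩ h
    simp only [Finset.mem_sigma, mem_cuts] at h ⊢
    obtain ⟨⟨h₁, h₂⟩, ⟨h₃, h₄⟩⟩ := h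
    refine ⟨⟨?_, ?_⟩, ?_, ?_⟩ <;> grind
  · rintro ⟨U, W⟩ h
    simp only [Finset.mem_sigma, mem_cuts] at h ⊢
    obtain ⟨⟨h₁, h₂⟩, ⟨h₃, h₄⟩⟩ := h
    refine ⟨⟨?_, ?_⟩, ?_, ?_⟩ <;> grind
  · rintro ⟨U, W⟩ h
    simp only [Finset.mem_sigma, mem_cuts] at h
    simp only [Set.union_sdiff_cancel h.2.subset]
  · rintro ⟨U, W⟩ h
    simp only [Finset.mem_sigma, mem_cuts] at h
    obtain ⟨⟨h₁, h₂⟩, ⟨h₃, h₄⟩⟩ := h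
    have : (U ∪ W) \ U = W := by ext x; grind
    simp only [this]
  · rintro ⟨U, W⟩ h
    simp only [Finset.mem_sigma, mem_cuts] at h
    obtain ⟨⟨h₁, h₂⟩, ⟨h₃, h₄⟩⟩ := h
    have : (A \ W) \ (U \ W) = A \ U := by ext x; grind
    simp only [this]

end combinatorics

end

/-! ### Compatibility of extensions and cuts -/

section

variable {V : Type u} [AddCommGroup V] [Module ℝ V]

/-- The two separation types of a product and a coproduct that form a bialgebra. -/
def IsDual (p n : Prop → Prop → Prop) : Prop :=
  p = NotBelow ∧ n = Incomparable ∨ p = Incomparable ∧ n = NotBelow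

/-- This serves pairs with one element in the cut-off part of `A` and the other in the remaining
part of `B`. For the opposite diagonal the cut condition has the reverse orientation, which is the
form in `IsDual.right`. -/
theorem IsDual.left {p n : Prop → Prop → Prop} (h : IsDual p n) {a b : Prop} (hp : p a b)
    (hn : n a b) : ¬ a ∧ ¬ b := by
  rcases h with ⟨rfl, rfl⟩ | ⟨rfl, rfl⟩
  exacts [hn, hp]

theorem IsDual.right {p n : Prop → Prop → Prop} (h : IsDual p n) {a b : Prop} (hp : p a b)
    (hn : n b a) : ¬ a ∧ ¬ b := by
  rcases h with ⟨rfl, rfl⟩ | ⟨rfl, rfl⟩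
  exacts [hn.symm, hp]

theorem IsDual.of_not {p n : Prop → Prop → Prop} (h : IsDual p n) {a b : Prop} (ha : ¬ a)
    (hb : ¬ b) : p a b ∧ n a b ∧ n b a := by
  rcases h with ⟨rfl, rfl⟩ | ⟨rfl, rfl⟩
  exacts [⟨ha, ⟨ha, hb⟩, ⟨hb, ha⟩⟩, ⟨⟨ha, hb⟩, ha, hb⟩]

section combinatorics

variable {X : Type w} {p n : Prop → Prop → Prop} {r : X → X → Prop} {A B : Set X}

/-- An extension of two forests that can be cut into two forests is a forest. -/
theorem IsDual.isForestOn_union (h : IsDual p n) (hAB : Disjoint A B) (hA : IsForestOn r A)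
    (hB : IsForestOn r B) {R : X → X → Prop} (hR : IsExtension p r A B R) {W : Set X}
    (hW : IsCut n R (A ∪ B) W) (h₁ : IsForestOn R W) (h₂ : IsForestOn R ((A ∪ B) \ W)) :
    IsForestOn R (A ∪ B) := by
  -- Whichever condition is `Incomparable` displays `A ∪ B` as a disjoint union of two unrelated
  -- forests: the two sides of the cut in the first case, `A` and `B` in the second.
  rcases h with ⟨rfl, rfl⟩ | ⟨rfl, rfl⟩
  · rw [← Set.union_sdiff_cancel hW.subset]
    exact h₁.union h₂ disjoint_sdiff_self_right (fun x hx y hy => (hW.sep x hx y hy).1)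
      fun x hx y hy => (hW.sep x hx y hy).2
  · exact (hA.congr fun x hx y hy => (hR.left hAB x hx y hy).symm).union
      (hB.congr fun x hx y hy => (hR.right hAB x hx y hy).symm) hAB
      (fun x hx y hy => (hR.sep x hx y hy).1) fun x hx y hy => (hR.sep x hx y hy).2

/-- The relation `r` without the pairs that relate an element of `A` and one of `B`. -/
def unlink (r : X → X → Prop) (A B : Set X) (x y : X) : Prop :=
  ¬ (x ∈ A ∧ y ∈ B ∨ x ∈ B ∧ y ∈ A) ∧ r x y

theorem unlink_of {r : X → X → Prop} {A B : Set X} {x y : X}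
    (h : x ∈ A ∧ y ∈ B ∨ x ∈ B ∧ y ∈ A) : unlink r A B x y = False := by
  simp [unlink, h]

theorem unlink_of_not {r : X → X → Prop} {A B : Set X} {x y : X}
    (h : ¬ (x ∈ A ∧ y ∈ B ∨ x ∈ B ∧ y ∈ A)) : unlink r A B x y = r x y := by
  simp [unlink, h]

/-- Cutting an extension amounts to cutting both parts and extending the pieces. -/
theorem IsDual.sum_extensions_cuts [Finite X] {M : Type*} [AddCommMonoid M] (h : IsDual p n)
    (hAB : Disjoint A B) (f : (X → X → Prop) → Set X → M)
    (g : Set X → (X → X → Prop) → (X → X → Prop) → M)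
    (hfg : ∀ (R R₁ R₂ : X → X → Prop) (W : Set X), (∀ x ∈ W, ∀ y ∈ W, (R x y ↔ R₁ x y)) →
      (∀ x ∈ (A ∪ B) \ W, ∀ y ∈ (A ∪ B) \ W, (R x y ↔ R₂ x y)) → f R W = g W R₁ R₂) :
    ∑ R ∈ extensions p r A B, ∑ W ∈ cuts n R (A ∪ B), f R W =
      ∑ U ∈ cuts n r A, ∑ U' ∈ cuts n r B, ∑ R₁ ∈ extensions p r U U',
        ∑ R₂ ∈ extensions p r (A \ U) (B \ U'), g (U ∪ U') R₁ R₂ := by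
  simp only [Finset.sum_sigma']
  have hl := fun a b => h.left (a := a) (b := b)
  have hr := fun a b => h.right (a := a) (b := b)
  have ho := fun a b => h.of_not (a := a) (b := b)
  rw [Set.disjoint_left] at hAB
  -- The inverse map rebuilds the relation blockwise: `R₁` between `U` and `U'`, `R₂` between their
  -- complements, nothing between diagonally opposite blocks, and `r` for all other pairs.
  let J : Set X → Set X → (X → X → Prop) → (X → X → Prop) → X → X → Prop := fun U U' R₁ R₂ =>
    patch R₁ (patch R₂ (unlink r A B) (A \ U) (B \ U')) U U'
  -- These five values describe `J` on every pair, so its definition can be forgotten afterwards.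
  have hJ : ∀ U U' R₁ R₂, U ⊆ A → U' ⊆ B →
      (∀ x y, (x ∈ U ∧ y ∈ U' ∨ x ∈ U' ∧ y ∈ U) → J U U' R₁ R₂ x y = R₁ x y) ∧
      (∀ x y, (x ∈ A \ U ∧ y ∈ B \ U' ∨ x ∈ B \ U' ∧ y ∈ A \ U) →
        J U U' R₁ R₂ x y = R₂ x y) ∧
      (∀ x y, (x ∈ U ∧ y ∈ B \ U' ∨ x ∈ B \ U' ∧ y ∈ U) → ¬ J U U' R₁ R₂ x y) ∧
      (∀ x y, (x ∈ A \ U ∧ y ∈ U' ∨ x ∈ U' ∧ y ∈ A \ U) → ¬ J U U' R₁ R₂ x y) ∧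
      (∀ x y, ¬ (x ∈ A ∧ y ∈ B ∨ x ∈ B ∧ y ∈ A) → J U U' R₁ R₂ x y = r x y) := by
    intro U U' R₁ R₂ hU hU'
    refine ⟨?_, ?_, ?_, ?_, ?_⟩ <;> intro x y hxy <;>
      grind [patch_of, patch_of_not, unlink_of, unlink_of_not]
  refine Finset.sum_bij'
    (fun s _ => ⟨s.2 ∩ A, s.2 ∩ B, patch s.1 r (s.2 ∩ A) (s.2 ∩ B),
      patch s.1 r (A \ (s.2 ∩ A)) (B \ (s.2 ∩ B))⟩)
    (fun s _ => ⟨J s.1 s.2.1 s.2.2.1 s.2.2.2, s.1 ∪ s.2.1⟩) ?_ ?_ ?_ ?_ ?_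
  · rintro ⟨R, W⟩ hm
    simp only [Finset.mem_sigma, mem_cuts, mem_extensions] at hm ⊢
    obtain ⟨⟨h₁, h₂⟩, ⟨h₃, h₄⟩⟩ := hm
    refine ⟨⟨?_, ?_⟩, ⟨?_, ?_⟩, ⟨?_, ?_⟩, ?_, ?_⟩ <;> grind [patch_of, patch_of_not]
  · rintro ⟨U, U', R₁, R₂⟩ hm
    simp only [Finset.mem_sigma, mem_cuts, mem_extensions] at hm ⊢
    obtain ⟨⟨h₁, h₂⟩, ⟨h₃, h₄⟩, ⟨h₅, h₆⟩, ⟨h₇, h₈⟩⟩ := hm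
    have := hJ U U' R₁ R₂ h₁ h₃
    generalize J U U' R₁ R₂ = K at this
    obtain ⟨k₁, k₂, k₃, k₄, k₅⟩ := this
    refine ⟨⟨?_, ?_⟩, ?_, ?_⟩
    · grind
    · grind
    · grind
    · grind
  · rintro ⟨R, W⟩ hm
    simp only [Finset.mem_sigma, mem_cuts, mem_extensions] at hm
    obtain ⟨⟨h₁, h₂⟩, ⟨h₃, h₄⟩⟩ := hm
    have := hJ (W ∩ A) (W ∩ B) (patch R r (W ∩ A) (W ∩ B))
      (patch R r (A \ (W ∩ A)) (B \ (W ∩ B))) Set.inter_subset_right Set.inter_subset_right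
    obtain ⟨k₁, k₂, k₃, k₄, k₅⟩ := this
    have hW : W ∩ A ∪ W ∩ B = W := by rw [← Set.inter_union_distrib_left]; grind
    have hK : J (W ∩ A) (W ∩ B) (patch R r (W ∩ A) (W ∩ B))
        (patch R r (A \ (W ∩ A)) (B \ (W ∩ B))) = R := by
      funext x y
      by_cases hxy : x ∈ A ∧ y ∈ B ∨ x ∈ B ∧ y ∈ A
      · grind [patch_of]
      · grind
    simp only [hW, hK]
  · rintro ⟨U, U', R₁, R₂⟩ hm
    simp only [Finset.mem_sigma, mem_cuts, mem_extensions] at hm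
    obtain ⟨⟨h₁, h₂⟩, ⟨h₃, h₄⟩, ⟨h₅, h₆⟩, ⟨h₇, h₈⟩⟩ := hm
    have := hJ U U' R₁ R₂ h₁ h₃
    simp only
    generalize J U U' R₁ R₂ = K at this
    obtain ⟨k₁, k₂, k₃, k₄, k₅⟩ := this
    have e₁ : (U ∪ U') ∩ A = U := by ext x; grind
    have e₂ : (U ∪ U') ∩ B = U' := by ext x; grind
    have e₃ : patch K r U U' = R₁ := by
      funext x y
      by_cases hxy : x ∈ U ∧ y ∈ U' ∨ x ∈ U' ∧ y ∈ U
      · rw [patch_of hxy, k₁ x y hxy]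
      · rw [patch_of_not hxy]; grind
    have e₄ : patch K r (A \ U) (B \ U') = R₂ := by
      funext x y
      by_cases hxy : x ∈ A \ U ∧ y ∈ B \ U' ∨ x ∈ B \ U' ∧ y ∈ A \ U
      · rw [patch_of hxy, k₂ x y hxy]
      · rw [patch_of_not hxy]; grind
    simp only [e₁, e₂, e₃, e₄]
  · rintro ⟨R, W⟩ hm
    simp only [Finset.mem_sigma, mem_cuts, mem_extensions] at hm
    obtain ⟨⟨h₁, h₂⟩, ⟨h₃, h₄⟩⟩ := hm
    have hW : W ∩ A ∪ W ∩ B = W := by rw [← Set.inter_union_distrib_left]; grind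
    simp only [hW]
    refine hfg _ _ _ _ ?_ ?_ <;> grind [patch_of, patch_of_not]

end combinatorics

end

/-! ### The bialgebra axioms -/

namespace TreeSpace

variable {V : Type u} [AddCommGroup V] [Module ℝ V]
  {p n : Prop → Prop → Prop} {mul : TreeSpace V →ₗ[ℝ] TreeSpace V →ₗ[ℝ] TreeSpace V}
  {comul : TreeSpace V →ₗ[ℝ] TreeSpace V ⊗[ℝ] TreeSpace V}

theorem eta_one : eta V 1 = one V := by
  rw [eta, LinearMap.toSpanSingleton_apply, one_smul]

namespace IsForestMul

theorem assoc (hp : IsForestMul p mul) (x y z : TreeSpace V) :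
    mul (mul x y) z = mul x (mul y z) := by
  -- The right-hand side is the trilinear form of `mul x (mul y z)`.
  have : mul.compr₂ mul = LinearMap.lcomp ℝ _ mul ∘ₗ LinearMap.llcomp ℝ _ _ _ ∘ₗ mul := by
    refine hom_ext_forest₃ fun X _ r l A B C _ _ _ hAB hAC hBC => ?_
    change mul (mul _ _) _ = mul _ (mul _ _)
    have hl : mul (mul (forest r l A) (forest r l B)) (forest r l C) =
        ∑ R ∈ extensions p r A B, ∑ Q ∈ extensions p R (A ∪ B) C, forest Q l (A ∪ B ∪ C) := by
      rw [hp r l hAB, map_sum, LinearMap.sum_apply]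
      refine Finset.sum_congr rfl fun R hR => ?_
      rw [mem_extensions] at hR
      rw [← hp R l (Disjoint.union_left hAC hBC)]
      -- The relations `R` and `r` differ only between `A` and `B`, hence agree on `C`.
      refine congrArg _ (forest_congr fun x hx y hy => (hR.iff_of_not x y ?_ ?_).symm)
      · exact fun h => Set.disjoint_left.1 hAC h.1 hx
      · exact fun h => Set.disjoint_left.1 hAC h.2 hy
    have hr : mul (forest r l A) (mul (forest r l B) (forest r l C)) =
        ∑ R ∈ extensions p r B C, ∑ Q ∈ extensions p R A (B ∪ C), forest Q l (A ∪ (B ∪ C)) := by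
      rw [hp r l hBC, map_sum]
      refine Finset.sum_congr rfl fun R hR => ?_
      rw [mem_extensions] at hR
      rw [← hp R l (Disjoint.union_right hAB hAC)]
      congr 2
      refine forest_congr fun x hx y hy => (hR.iff_of_not x y ?_ ?_).symm
      · exact fun h => Set.disjoint_left.1 hAB hx h.1
      · exact fun h => Set.disjoint_left.1 hAC hx h.1
    rw [hl, hr, sum_extensions_left hAB hAC hBC, sum_extensions_right hAB hAC hBC, Set.union_assoc]
  exact LinearMap.congr_fun (LinearMap.congr_fun₂ this x y) z

theorem one_mul (hp : IsForestMul p mul) (x : TreeSpace V) : mul (one V) x = x := by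
  have : mul (one V) = LinearMap.id := hom_ext_forest fun X _ r l A _ => by
    rw [← forest_empty r l, hp r l (Set.empty_disjoint A), extensions_empty_left,
      Finset.sum_singleton, Set.empty_union, LinearMap.id_apply]
  exact LinearMap.congr_fun this x

theorem mul_one (hp : IsForestMul p mul) (x : TreeSpace V) : mul x (one V) = x := by
  have : mul.flip (one V) = LinearMap.id := hom_ext_forest fun X _ r l A _ => by
    rw [LinearMap.flip_apply, ← forest_empty r l, hp r l (Set.disjoint_empty A),
      extensions_empty_right, Finset.sum_singleton, Set.union_empty, LinearMap.id_apply]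
  exact LinearMap.congr_fun this x

theorem epsilon_mul (hp : IsForestMul p mul) (x y : TreeSpace V) :
    epsilon V (mul x y) = epsilon V x * epsilon V y := by
  have : mul.compr₂ (epsilon V) = (LinearMap.mul ℝ ℝ).compl₁₂ (epsilon V) (epsilon V) := by
    refine hom_ext_forest₂ fun X _ r l A B _ _ hAB => ?_
    rw [LinearMap.compr₂_apply, LinearMap.compl₁₂_apply, LinearMap.mul_apply']
    rcases A.eq_empty_or_nonempty with rfl | hA
    · rw [forest_empty, hp.one_mul, epsilon_one, _root_.one_mul]
    · rw [hp r l hAB, map_sum, epsilon_forest hA, zero_mul]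
      exact Finset.sum_eq_zero fun R _ => epsilon_forest (hA.mono Set.subset_union_left)
  exact LinearMap.congr_fun₂ this x y

end IsForestMul

namespace IsForestComul

theorem coassoc (hn : IsForestComul n comul) :
    TensorProduct.assoc ℝ (TreeSpace V) (TreeSpace V) (TreeSpace V) ∘ₗ
      comul.rTensor (TreeSpace V) ∘ₗ comul = comul.lTensor (TreeSpace V) ∘ₗ comul := by
  refine hom_ext_forest fun X _ r l A hA => ?_
  simp only [LinearMap.comp_apply, LinearEquiv.coe_coe, hn l hA, map_sum, LinearMap.rTensor_tmul,
    LinearMap.lTensor_tmul]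
  refine Eq.trans (Finset.sum_congr rfl fun U hU => ?_) ((sum_cuts_cuts A fun U W Z =>
    forest r l U ⊗ₜ[ℝ] (forest r l W ⊗ₜ[ℝ] forest r l Z)).trans
      (Finset.sum_congr rfl fun U hU => ?_))
  · rw [hn l (hA.mono (mem_cuts.1 hU).subset), TensorProduct.sum_tmul, map_sum]
    rfl
  · rw [hn l (hA.mono Set.sdiff_subset), TensorProduct.tmul_sum]

theorem rTensor_epsilon (hn : IsForestComul n comul) :
    (epsilon V).rTensor (TreeSpace V) ∘ₗ comul = TensorProduct.mk ℝ ℝ (TreeSpace V) 1 := by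
  refine hom_ext_forest fun X _ r l A hA => ?_
  simp only [LinearMap.comp_apply, hn l hA, map_sum, LinearMap.rTensor_tmul, TensorProduct.mk_apply]
  rw [Finset.sum_eq_single_of_mem ∅ (mem_cuts.2 ⟨Set.empty_subset A, by simp⟩) fun U _ hU => ?_]
  · rw [forest_empty, epsilon_one, Set.sdiff_empty]
  · rw [epsilon_forest (Set.nonempty_iff_ne_empty.2 hU), TensorProduct.zero_tmul]

theorem lTensor_epsilon (hn : IsForestComul n comul) :
    (epsilon V).lTensor (TreeSpace V) ∘ₗ comul = (TensorProduct.mk ℝ (TreeSpace V) ℝ).flip 1 := by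
  refine hom_ext_forest fun X _ r l A hA => ?_
  simp only [LinearMap.comp_apply, hn l hA, map_sum, LinearMap.lTensor_tmul, TensorProduct.mk_apply,
    LinearMap.flip_apply]
  rw [Finset.sum_eq_single_of_mem A (mem_cuts.2 ⟨subset_rfl, by simp⟩) fun U hU hne => ?_]
  · rw [Set.sdiff_self, forest_empty, epsilon_one]
  · rw [epsilon_forest, TensorProduct.tmul_zero]
    exact Set.sdiff_nonempty.2 fun h => hne ((mem_cuts.1 hU).subset.antisymm h)

theorem comul_one (hn : IsForestComul n comul) : comul (one V) = one V ⊗ₜ one V := by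
  have hc : cuts n (fun _ _ => True) (∅ : Set Empty) = {∅} := by
    ext U
    rw [mem_cuts, Finset.mem_singleton]
    exact ⟨fun h => Set.subset_empty_iff.1 h.subset, fun h => ⟨h.le, fun x => x.elim⟩⟩
  have := hn (fun _ => (0 : V)) (isForestOn_empty (X := Empty) fun _ _ => True)
  rwa [hc, Finset.sum_singleton, Set.sdiff_self, forest_empty] at this

theorem comul_mul (hn : IsForestComul n comul) (hp : IsForestMul p mul) (hpn : IsDual p n)
    (x y : TreeSpace V) :
    comul (mul x y) = TensorProduct.map₂ mul mul (comul x) (comul y) := by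
  have : mul.compr₂ comul = (TensorProduct.map₂ mul mul).compl₁₂ comul comul := by
    refine hom_ext_forest₂ fun X _ r l A B hA hB hAB => ?_
    rw [LinearMap.compr₂_apply, LinearMap.compl₁₂_apply, hn l hA, hn l hB, hp r l hAB]
    simp only [map_sum, LinearMap.sum_apply, TensorProduct.map₂_apply_tmul, TensorProduct.map_tmul]
    rw [Finset.sum_comm]
    have hr : ∀ U ∈ cuts n r A, ∀ U' ∈ cuts n r B,
        mul (forest r l U) (forest r l U') ⊗ₜ[ℝ]
          mul (forest r l (A \ U)) (forest r l (B \ U')) =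
        ∑ R₁ ∈ extensions p r U U', ∑ R₂ ∈ extensions p r (A \ U) (B \ U'),
          forest R₁ l (U ∪ U') ⊗ₜ[ℝ] forest R₂ l ((A ∪ B) \ (U ∪ U')) := by
      intro U hU U' hU'
      have hU := (mem_cuts.1 hU).subset
      have hU' := (mem_cuts.1 hU').subset
      have he : A \ U ∪ B \ U' = (A ∪ B) \ (U ∪ U') := by
        rw [Set.disjoint_left] at hAB
        ext x
        grind
      rw [hp r l (hAB.mono hU hU'), hp r l (hAB.mono Set.sdiff_subset Set.sdiff_subset), he,
        TensorProduct.sum_tmul]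
      exact Finset.sum_congr rfl fun R _ => TensorProduct.tmul_sum _ _ _
    have hl : ∀ R ∈ extensions p r A B, comul (forest R l (A ∪ B)) =
        ∑ W ∈ cuts n R (A ∪ B), forest R l W ⊗ₜ[ℝ] forest R l ((A ∪ B) \ W) := by
      intro R hR
      -- For an extension that is not a forest the left side is zero, while `hn` says nothing about
      -- the sum. The sum vanishes because two forest pieces would force `R` to be a forest on `A ∪
      -- B`.
      by_cases hF : IsForestOn R (A ∪ B)
      · exact hn l hF
      rw [forest_of_not hF, map_zero]
      refine (Finset.sum_eq_zero fun W hW => ?_).symm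
      by_cases h₁ : IsForestOn R W
      · rw [forest_of_not fun h₂ => hF (hpn.isForestOn_union hAB hA hB (mem_extensions.1 hR)
          (mem_cuts.1 hW) h₁ h₂), TensorProduct.tmul_zero]
      · rw [forest_of_not h₁, TensorProduct.zero_tmul]
    rw [Finset.sum_congr rfl hl, hpn.sum_extensions_cuts hAB _
      (fun W R₁ R₂ => forest R₁ l W ⊗ₜ[ℝ] forest R₂ l ((A ∪ B) \ W)) fun R R₁ R₂ W h₁ h₂ => by
        rw [forest_congr h₁, forest_congr h₂]]
    exact (Finset.sum_congr rfl fun U hU => Finset.sum_congr rfl fun U' hU' =>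
      hr U hU U' hU').symm
  exact LinearMap.congr_fun₂ this x y

end IsForestComul

/-! ### The grading -/

theorem of_mem_homogeneous (t : NPTree) (x : TreePower V t) :
    of V t x ∈ homogeneous V t.degree :=
  Submodule.mem_iSup_of_mem t (Submodule.mem_iSup_of_mem rfl ⟨x, rfl⟩)

theorem forest_mem_homogeneous {X : Type w} (r : X → X → Prop) (l : X → V) (A : Set X) :
    forest r l A ∈ homogeneous V A.ncard := by
  by_cases h : IsForestOn r A
  · obtain ⟨T, j, hj⟩ := h
    rw [← cls_eq_forest hj, ← hj.natCard]
    exact of_mem_homogeneous T.toTree _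
  · rw [forest_of_not h]
    exact zero_mem _

theorem homogeneous_le {k : ℕ} {N : Submodule ℝ (TreeSpace V)}
    (h : ∀ (T : RTree) (l : T.Vert → V), Nat.card T.Vert = k →
      T.cls (PiTensorProduct.tprod ℝ l) ∈ N) : homogeneous V k ≤ N := by
  refine iSup_le fun t => iSup_le fun ht => ?_
  rintro _ ⟨x, rfl⟩
  obtain ⟨x, rfl⟩ := Submodule.Quotient.mk_surjective _ x
  rw [← NPTree.cls_rep]
  have hk : Nat.card t.rep.Vert = k := by
    rw [← ht]
    conv_rhs => rw [← Quotient.out_eq t]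
    rfl
  induction x using PiTensorProduct.induction_on with
  | smul_tprod a l => rw [map_smul]; exact N.smul_mem _ (h _ _ hk)
  | add x y hx hy => rw [map_add]; exact add_mem hx hy

theorem homogeneous_le_forest {k : ℕ} {N : Submodule ℝ (TreeSpace V)}
    (h : ∀ (X : Type) [Finite X] (r : X → X → Prop) (l : X → V) (A : Set X), IsForestOn r A →
      A.ncard = k → forest r l A ∈ N) : homogeneous V k ≤ N := by
  refine homogeneous_le fun T l hk => ?_
  have hT : T.Models id (fun v w => v ≤ w) Set.univ :=
    ⟨Function.injective_id, Set.range_id, fun _ _ => Iff.rfl⟩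
  have := h T.Vert _ l Set.univ ⟨T, _, hT⟩ (hT.natCard ▸ hk)
  rwa [← cls_eq_forest hT l] at this

theorem isInternal_homogeneous : DirectSum.IsInternal (homogeneous V) := by
  rw [DirectSum.isInternal_submodule_iff_iSupIndep_and_iSup_eq_top]
  constructor
  · rw [iSupIndep_def]
    intro k
    -- The projection onto degree `k` is the identity on `homogeneous V k` and kills all other
    -- degrees, which gives independence.
    let π : TreeSpace V →ₗ[ℝ] TreeSpace V :=
      DirectSum.toModule ℝ NPTree _ fun t => if t.degree = k then of V t else 0
    have hπ : ∀ t x, π (of V t x) = if t.degree = k then of V t x else 0 := by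
      intro t x
      refine (DirectSum.toModule_lof ℝ t x).trans ?_
      split_ifs <;> rfl
    have h₁ : homogeneous V k ≤ LinearMap.eqLocus π LinearMap.id := by
      refine iSup_le fun t => iSup_le fun ht => ?_
      rintro _ ⟨x, rfl⟩
      exact (hπ t x).trans (if_pos ht)
    have h₂ : ⨆ (j : ℕ) (_ : j ≠ k), homogeneous V j ≤ LinearMap.ker π := by
      refine iSup_le fun j => iSup_le fun hj => iSup_le fun t => iSup_le fun ht => ?_
      rintro _ ⟨x, rfl⟩
      exact (hπ t x).trans (if_neg fun h => hj (ht.symm.trans h))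
    rw [Submodule.disjoint_def]
    exact fun x hx hx' => (h₁ hx).symm.trans (h₂ hx')
  · have : (⨆ k, homogeneous V k).mkQ = 0 := hom_ext_forest fun X _ r l A _ =>
      (Submodule.Quotient.mk_eq_zero _).2
        (Submodule.mem_iSup_of_mem A.ncard (forest_mem_homogeneous r l A))
    rw [← Submodule.ker_mkQ (⨆ k, homogeneous V k), this, LinearMap.ker_zero]

theorem isConnectedGrading (hp : IsForestMul p mul) (hn : IsForestComul n comul) :
    IsConnectedGrading (homogeneous V) mul (eta V) comul (epsilon V) where
  isInternal := isInternal_homogeneous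
  mul_mem i j x y hx hy := by
    -- The infimum consists of those `x` whose products with all `z` of degree `j` have degree `i +
    -- j`. Being a submodule, it can be tested on elementary labelled trees before `z` is reduced to
    -- such trees.
    have h : homogeneous V i ≤
        ⨅ z ∈ homogeneous V j, (homogeneous V (i + j)).comap (mul.flip z) := by
      refine homogeneous_le fun T l hT => ?_
      simp only [Submodule.mem_iInf]
      intro z hz
      suffices homogeneous V j ≤
        (homogeneous V (i + j)).comap (mul (T.cls (PiTensorProduct.tprod ℝ l))) from this hz
      refine homogeneous_le fun S m hS => ?_
      obtain ⟨X, _, r, L, A, B, -, j', k, -, hT', hS', -, hAB, -, -, rfl, rfl, -⟩ :=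
        RTree.exists_models₃ T S RTree.single l m 0
      rw [Submodule.mem_comap, cls_eq_forest hT', cls_eq_forest hS', hp r L hAB, ← hT, ← hS,
        hT'.natCard, hS'.natCard, ← Set.ncard_union_eq hAB]
      exact sum_mem fun R _ => forest_mem_homogeneous R L _
    have := h hx
    simp only [Submodule.mem_iInf] at this
    exact this y hy
  comul_mem k x hx := by
    suffices homogeneous V k ≤ (⨆ (i : ℕ) (j : ℕ) (_ : i + j = k), LinearMap.range
      (TensorProduct.map (homogeneous V i).subtype (homogeneous V j).subtype)).comap comul from
        this hx
    refine homogeneous_le_forest fun X _ r l A hA hk => ?_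
    rw [Submodule.mem_comap, hn l hA]
    refine sum_mem fun U hU => Submodule.mem_iSup_of_mem U.ncard <|
      Submodule.mem_iSup_of_mem (A \ U).ncard <| Submodule.mem_iSup_of_mem ?_ ?_
    · rw [← hk, ← Set.ncard_union_eq disjoint_sdiff_self_right,
        Set.union_sdiff_cancel (mem_cuts.1 hU).subset]
    · exact ⟨⟨_, forest_mem_homogeneous r l U⟩ ⊗ₜ ⟨_, forest_mem_homogeneous r l (A \ U)⟩, rfl⟩
  counit_eq_zero k x hk hx := by
    suffices homogeneous V k ≤ LinearMap.ker (epsilon V) from this hx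
    refine homogeneous_le_forest fun X _ r l A hA hA' => epsilon_forest ?_
    exact Set.nonempty_of_ncard_ne_zero (hA' ▸ hk)
  unit_injective a b hab := by
    have := congrArg (epsilon V) hab
    simpa [eta, LinearMap.toSpanSingleton_apply, epsilon_one] using this
  range_unit := by
    refine le_antisymm ?_ (homogeneous_le_forest fun X _ r l A hA hk => ?_)
    · rintro _ ⟨a, rfl⟩
      rw [eta, LinearMap.toSpanSingleton_apply]
      refine Submodule.smul_mem _ _ ?_
      have := forest_mem_homogeneous (fun _ _ => True) (fun _ : Empty => (0 : V)) ∅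
      rwa [forest_empty, Set.ncard_empty] at this
    · rw [(Set.ncard_eq_zero).1 hk, forest_empty]
      exact ⟨1, eta_one⟩

/-! ### The two Hopf algebras -/

theorem isHopfAlgebra (hp : IsForestMul p mul) (hn : IsForestComul n comul) (hpn : IsDual p n) :
    IsHopfAlgebra mul (eta V) comul (epsilon V) := by
  refine (isConnectedGrading hp hn).isHopfAlgebra hp.assoc ?_ ?_ hn.coassoc hn.rTensor_epsilon
    hn.lTensor_epsilon ?_ hp.epsilon_mul ?_ (hn.comul_mul hp hpn)
  · rw [eta_one]; exact hp.one_mul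
  · rw [eta_one]; exact hp.mul_one
  · rw [eta_one, epsilon_one]
  · rw [eta_one, hn.comul_one]

theorem isForestMul_star : IsForestMul NotBelow (star V) := fun r l _ _ => star_forest r l

theorem isForestMul_circ : IsForestMul Incomparable (circ V) := fun r l _ _ => circ_forest r l

theorem isForestComul_deltaGL : IsForestComul Incomparable (deltaGL V) :=
  fun l _ => deltaGL_forest l

theorem isForestComul_deltaCK : IsForestComul NotBelow (deltaCK V) :=
  fun l _ => deltaCK_forest l

end TreeSpace

theorem mainTheorem3 (V : Type u) [AddCommGroup V] [Module ℝ V] :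
    (IsHopfAlgebra (TreeSpace.star V) (TreeSpace.eta V) (TreeSpace.deltaGL V)
        (TreeSpace.epsilon V) ∧
      IsConnectedGrading (TreeSpace.homogeneous V) (TreeSpace.star V) (TreeSpace.eta V)
        (TreeSpace.deltaGL V) (TreeSpace.epsilon V)) ∧
    (IsHopfAlgebra (TreeSpace.circ V) (TreeSpace.eta V) (TreeSpace.deltaCK V)
        (TreeSpace.epsilon V) ∧
      IsConnectedGrading (TreeSpace.homogeneous V) (TreeSpace.circ V) (TreeSpace.eta V)
        (TreeSpace.deltaCK V) (TreeSpace.epsilon V)) :=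
  open TreeSpace in
  ⟨⟨isHopfAlgebra isForestMul_star isForestComul_deltaGL (Or.inl ⟨rfl, rfl⟩),
    isConnectedGrading isForestMul_star isForestComul_deltaGL⟩,
    ⟨isHopfAlgebra isForestMul_circ isForestComul_deltaCK (Or.inr ⟨rfl, rfl⟩),
      isConnectedGrading isForestMul_circ isForestComul_deltaCK⟩⟩
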